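/- Let $n\ge 1$, $D\ge 0$, let $f=(f_1,\dots,f_D)$ with $f_i:\mathbb R^D\to\mathbb R^n$ continuous, and let $u:\mathbb R^n\times[0,\infty)\to\mathbb R^D$ be a measurable weak solution of $$u_t+\nabla\cdot f(u)=0,\qquad u(\cdot,0)=u_0\in (L^1(\mathbb R^n)\cap L^\infty(\mathbb R^n))^D,$$ that is, $\sum_{i=1}^D\int_{t_1}^{t_2}\int_{V}[u_i\,\partial_t\phi_i+f_i(u)\cdot\nabla_x\phi_i]\,dx\,dt=0$ for every bounded open $V\subseteq\mathbb R^n$, all $0\le t_1<t_2$ and every $\phi\in C_0^\infty(V\times(t_1,t_2))^D$. Assume that $u$ is (essentially) bounded on compact subsets of $\mathbb R^n\times[0,\infty)$ and that for every bounded open $V\subseteq\mathbb R^n$ the mass $m(t)=\int_V u(x,t)\,dx$ is well defined for every $t\ge0$ and is a continuous function of $t\in[0,\infty)$. Let $\Omega\subseteq\mathbb R^n$ be a nonempty bounded open set with $C^\infty$ boundary (for example, a bounded smooth domain). For small $|y|$ let $\Omega_y=\{x:\ \mathrm{dist}(x,\Omega)-\mathrm{dist}(x,\mathbb R^n\setminus\Omega)<y\}$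 (so $\Omega_0=\Omega$ and the hypersurfaces $\partial\Omega_y$ foliate a tubular neighbourhood of $\partial\Omega$, with $\partial/\partial y$ the outward unit normal). For $0\le t_1\le t_2$ the flux vector across $\partial\Omega$ over $[t_1,t_2]$, $$h_i(t_1,t_2)=\int_{t_1}^{t_2}\int_{\partial\Omega}f_i(u(x,t))\cdot\nu\,dS\,dt,\qquad i=1,\dots,D,$$ is understood in the sense of traces: it is the value $H(0)$ of a Lipschitz continuous function $H:(-\delta,\delta)\to\mathbb R^D$, for some $\delta>0$ such that $\Omega_y$ is a nonempty bounded open set with $C^\infty$ boundary for all $|y|<\delta$, which for almost every $y\in(-\delta,\delta)$ satisfies, for each $i$, that $f_i(u)\cdot\nu$ is integrable on $\partial\Omega_y\times[t_1,t_2]$ and $H_i(y)=\int_{t_1}^{t_2}\int_{\partial\Omega_y}f_i(u(x,t))\cdot\nu\,dS\,dt$. Here $\nu$ is the outward unit normal and $dS$ the surface Lebesgue measure on $\partial\Omega_y$. Then for all $0\le t_1\le t_2$ the flux $h(t_1,t_2)$ is well defined (it exists and is unique), and $h$ is a (jointly) continuous function of $(t_1,t_2)\in\{(t_1,t_2):0\le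 t_1\le t_2\}$. -/

import Mathlib

open MeasureTheory Set Topology
open scoped ContDiff

/-- The Euclidean space `ℝⁿ`. -/
abbrev RVec (n : ℕ) : Type := EuclideanSpace ℝ (Fin n)

/-! ### Domains with smooth boundary -/

/-- `ρ` is a smooth defining function of the set `Ω` near the point `p`: it is smooth near `p`, its
gradient does not vanish at `p`, and near `p` the set `Ω` is exactly `{ρ < 0}`. -/
def IsDefiningFunctionAt {n : ℕ} (Ω : Set (RVec n)) (p : RVec n) (ρ : RVec n → ℝ) : Prop :=
  ∃ U : Set (RVec n), IsOpen U ∧ p ∈ U ∧ ContDiffOn ℝ ∞ ρ U ∧ gradient ρ p ≠ 0 ∧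
    ∀ x ∈ U, x ∈ Ω ↔ ρ x < 0

/-- Nonempty bounded open sets with smooth boundary. Connectedness is not required. -/
structure IsSmoothBounded {n : ℕ} (Ω : Set (RVec n)) : Prop where
  isOpen : IsOpen Ω
  nonempty : Ω.Nonempty
  isBounded : Bornology.IsBounded Ω
  smooth_boundary : ∀ p ∈ frontier Ω, ∃ ρ : RVec n → ℝ, IsDefiningFunctionAt Ω p ρ

open Classical in
/-- The outward unit normal `∇ρ / |∇ρ|` of `Ω` at a boundary point `p`, where `ρ` is a defining
function of `Ω` near `p`. It does not depend on `ρ`, see `outwardNormal_eq`. -/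
noncomputable def outwardNormal {n : ℕ} (Ω : Set (RVec n)) (p : RVec n) : RVec n :=
  if h : ∃ ρ : RVec n → ℝ, IsDefiningFunctionAt Ω p ρ then
    ‖gradient h.choose p‖⁻¹ • gradient h.choose p
  else 0

/-- The outward unit normal given by a defining function does not depend on this function. -/
theorem IsDefiningFunctionAt.normal_unique {n : ℕ} {Ω : Set (RVec n)} (hΩ : IsOpen Ω)
    {p : RVec n} (hp : p ∈ frontier Ω) {ρ σ : RVec n → ℝ} (hρ : IsDefiningFunctionAt Ω p ρ)
    (hσ : IsDefiningFunctionAt Ω p σ) :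
    ‖gradient ρ p‖⁻¹ • gradient ρ p = ‖gradient σ p‖⁻¹ • gradient σ p := by
  have hpΩ : p ∉ Ω := by rw [hΩ.frontier_eq] at hp; exact hp.2
  have key : ∀ {τ : RVec n → ℝ}, IsDefiningFunctionAt Ω p τ → ∀ v : RVec n,
      HasDerivAt (fun s : ℝ => τ (p + s • v)) (inner ℝ (gradient τ p) v) 0 ∧ τ p = 0 ∧
      ∀ᶠ s in 𝓝 (0:ℝ), (p + s • v ∈ Ω ↔ τ (p + s • v) < 0) := by
    rintro τ ⟨U, hU, hpU, hτ, -, h⟩ v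
    have hd : DifferentiableAt ℝ τ p :=
      (hτ.contDiffAt (hU.mem_nhds hpU)).differentiableAt (by simp)
    have hline : HasDerivAt (fun s : ℝ => p + s • v) v 0 := by
      simpa using ((hasDerivAt_id (0:ℝ)).smul_const v).const_add p
    refine ⟨?_, ?_, ?_⟩
    · have h1 := hd.hasGradientAt.hasFDerivAt
      have h2 : HasFDerivAt τ (InnerProductSpace.toDual ℝ (RVec n) (gradient τ p))
        (p + (0:ℝ) • v) := by simpa using h1
      have h3 := h2.comp_hasDerivAt (0:ℝ) hline
      rw [InnerProductSpace.toDual_apply_apply] at h3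
      exact h3
    · apply le_antisymm
      · have hcl : p ∈ closure (Ω ∩ U) := by
          rw [inter_comm]
          exact hU.inter_closure ⟨hpU, frontier_subset_closure hp⟩
        by_contra hlt
        push Not at hlt
        have := hd.continuousAt.eventually (lt_mem_nhds hlt)
        obtain ⟨x, hx, hx1, hx2⟩ := mem_closure_iff_nhds.1 hcl _ this
        have := (h x hx2).1 hx1
        exact lt_asymm hx this
      · by_contra hlt
        push Not at hlt
        exact hpΩ ((h p hpU).2 hlt)
    · have : Filter.Tendsto (fun s : ℝ => p + s • v) (𝓝 0) (𝓝 p) := by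
        simpa using hline.continuousAt.tendsto
      filter_upwards [this (hU.mem_nhds hpU)] with s hs using h _ hs
  have hsign : ∀ v : RVec n, inner ℝ (gradient ρ p) v < 0 → inner ℝ (gradient σ p) v ≤ 0 := by
    intro v hv
    obtain ⟨a1, a2, a3⟩ := key hρ v
    obtain ⟨b1, b2, b3⟩ := key hσ v
    by_contra hlt
    push Not at hlt
    have e1 := a1.tendsto_slope_zero_right.eventually (gt_mem_nhds hv)
    have e2 := b1.tendsto_slope_zero_right.eventually (lt_mem_nhds hlt)
    obtain ⟨s, ⟨⟨h1, h2⟩, h3, h4⟩, h5⟩ := ((e1.and e2).and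
      ((a3.filter_mono nhdsWithin_le_nhds).and (b3.filter_mono nhdsWithin_le_nhds))
      |>.and self_mem_nhdsWithin).exists
    have hs : 0 < s := h5
    simp only [zero_add, zero_smul, add_zero, a2, b2, sub_zero, smul_eq_mul] at h1 h2
    have k1 : ρ (p + s • v) < 0 := by
      by_contra hc; push Not at hc
      exact absurd h1 (not_lt.2 (mul_nonneg (inv_nonneg.2 hs.le) hc))
    have k2 := h4.1 (h3.2 k1)
    exact absurd h2 (not_lt.2 (mul_nonpos_of_nonneg_of_nonpos (inv_nonneg.2 hs.le) k2.le))
  obtain ⟨_, _, _, _, ha, _⟩ := hρ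
  obtain ⟨_, _, _, _, hb, _⟩ := hσ
  set a := gradient ρ p
  set b := gradient σ p
  have ha' := norm_pos_iff.2 ha
  have hb' := norm_pos_iff.2 hb
  -- test with `v = ‖a‖ b - ‖b‖ a`, slightly perturbed along `-a`
  have hle : inner ℝ b (‖a‖ • b - ‖b‖ • a) ≤ 0 := by
    by_contra hlt
    push Not at hlt
    have hcs : inner ℝ a b ≤ ‖a‖ * ‖b‖ := real_inner_le_norm a b
    have e0 : inner ℝ a (‖a‖ • b - ‖b‖ • a) ≤ 0 := by
      rw [inner_sub_right, real_inner_smul_right, real_inner_smul_right,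
        real_inner_self_eq_norm_sq]
      nlinarith
    have hc : Filter.Tendsto (fun s : ℝ => inner ℝ b (‖a‖ • b - ‖b‖ • a - s • a)) (𝓝[>] 0)
        (𝓝 (inner ℝ b (‖a‖ • b - ‖b‖ • a))) := by
      have : Continuous (fun s : ℝ => inner ℝ b (‖a‖ • b - ‖b‖ • a - s • a)) := by fun_prop
      simpa using (this.tendsto 0).mono_left nhdsWithin_le_nhds
    obtain ⟨s, h1, h2⟩ := ((hc.eventually (lt_mem_nhds hlt)).and self_mem_nhdsWithin).exists
    have hs : 0 < s := h2
    have : inner ℝ a (‖a‖ • b - ‖b‖ • a - s • a) < 0 := by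
      rw [inner_sub_right, real_inner_smul_right, real_inner_self_eq_norm_sq]
      have : 0 < s * ‖a‖ ^ 2 := by positivity
      linarith
    exact absurd h1 (not_lt.2 (hsign _ this))
  have heq : inner ℝ a b = ‖a‖ * ‖b‖ := by
    apply le_antisymm (real_inner_le_norm a b)
    rw [inner_sub_right, real_inner_smul_right, real_inner_smul_right,
        real_inner_self_eq_norm_sq, real_inner_comm] at hle
    nlinarith
  have := inner_eq_norm_mul_iff_real.1 heq
  rw [inv_smul_eq_iff₀ ha'.ne', smul_comm, eq_inv_smul_iff₀ hb'.ne']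
  exact this

/-- The outward unit normal can be computed from any defining function. -/
theorem outwardNormal_eq {n : ℕ} {Ω : Set (RVec n)} (hΩ : IsOpen Ω) {p : RVec n}
    (hp : p ∈ frontier Ω) {ρ : RVec n → ℝ} (hρ : IsDefiningFunctionAt Ω p ρ) :
    outwardNormal Ω p = ‖gradient ρ p‖⁻¹ • gradient ρ p := by
  have h : ∃ ρ : RVec n → ℝ, IsDefiningFunctionAt Ω p ρ := ⟨ρ, hρ⟩
  rw [outwardNormal, dif_pos h]
  exact h.choose_spec.normal_unique hΩ hp hρ

/-- The signed distance to the boundary of `Ω`: negative inside `Ω`, positive outside `Ω`. -/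
noncomputable def signedBoundaryDist {n : ℕ} (Ω : Set (RVec n)) (x : RVec n) : ℝ :=
  Metric.infDist x Ω - Metric.infDist x Ωᶜ

/-- The family of expanding sets `Ω_y`, with `Ω_0 = Ω` for open `Ω` with nonempty complement. The
coordinate `y` is the signed distance, so near the boundary of a smooth bounded `Ω` the
hypersurfaces `∂Ω_y` foliate a tubular neighbourhood, and `∂/∂y` is the unit normal. -/
def parallelSet {n : ℕ} (Ω : Set (RVec n)) (y : ℝ) : Set (RVec n) :=
  {x | signedBoundaryDist Ω x < y}

theorem parallelSet_zero {n : ℕ} {Ω : Set (RVec n)} (hΩ : IsOpen Ω) (hne : Ωᶜ.Nonempty) :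
    parallelSet Ω 0 = Ω := by
  ext x
  simp only [parallelSet, signedBoundaryDist, mem_ofPred_eq]
  constructor
  · intro h
    by_contra hx
    have : Metric.infDist x Ωᶜ = 0 := Metric.infDist_zero_of_mem hx
    have := Metric.infDist_nonneg (x := x) (s := Ω)
    linarith
  · intro hx
    have h1 : Metric.infDist x Ω = 0 := Metric.infDist_zero_of_mem hx
    have h2 : 0 < Metric.infDist x Ωᶜ :=
      (hΩ.isClosed_compl.notMem_iff_infDist_pos hne).1 (by simpa using hx)
    linarith

/-! ### Weak solutions -/

/-- `u` is a weak solution of `uₜ + ∇ ⬝ f(u) = 0` in `ℝⁿ × (0, ∞)`. -/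
def IsWeakSolution {n D : ℕ} (f : RVec D → Fin D → RVec n) (u : RVec n → ℝ → RVec D) : Prop :=
  ∀ (V : Set (RVec n)) (t₁ t₂ : ℝ), IsOpen V → Bornology.IsBounded V → 0 ≤ t₁ → t₁ < t₂ →
    ∀ φ : RVec n × ℝ → RVec D, ContDiff ℝ ∞ φ → HasCompactSupport φ →
      tsupport φ ⊆ V ×ˢ Ioo t₁ t₂ →
      ∑ i : Fin D, ∫ t in t₁..t₂, ∫ x in V,
        (u x t i * deriv (fun s => φ (x, s) i) t +
          inner ℝ (f (u x t) i) (gradient (fun z => φ (z, t) i) x)) = 0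

/-- `u` is (essentially) bounded on bounded subsets of `ℝⁿ × [0, ∞)`. -/
def IsLocallyBounded {n D : ℕ} (u : RVec n → ℝ → RVec D) : Prop :=
  ∀ K : Set (RVec n × ℝ), IsCompact K → K ⊆ univ ×ˢ Ici 0 →
    ∃ C : ℝ, ∀ᵐ p ∂(volume.restrict K), ‖u p.1 p.2‖ ≤ C

/-- For every bounded open `V` the mass `m(t) = ∫_V u(x, t) dx` is well defined for each `t ≥ 0` and
is a continuous function of `t ∈ [0, ∞)`. -/
def HasContinuousMass {n D : ℕ} (u : RVec n → ℝ → RVec D) : Prop :=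
  ∀ V : Set (RVec n), IsOpen V → Bornology.IsBounded V →
    (∀ t : ℝ, 0 ≤ t → IntegrableOn (fun x => u x t) V) ∧
      ContinuousOn (fun t => ∫ x in V, u x t) (Ici 0)

/-! ### Fluxes -/

/-- The surface measure on the boundary of `Ω ⊆ ℝⁿ`: the `(n-1)`-dimensional Hausdorff measure,
normalized so that it extends Lebesgue measure on hyperplanes. -/
noncomputable def surfaceMeasure {n : ℕ} (Ω : Set (RVec n)) : Measure (RVec n) :=
  (Measure.euclideanHausdorffMeasure (n - 1)).restrict (frontier Ω)

/-- The normal component `f_i(u(x, t)) ⬝ ν(x)` of the `i`-th flux vector on the boundary of `Ω`. -/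
noncomputable def normalFlux {n D : ℕ} (f : RVec D → Fin D → RVec n) (u : RVec n → ℝ → RVec D)
    (Ω : Set (RVec n)) (i : Fin D) (x : RVec n) (t : ℝ) : ℝ :=
  inner ℝ (f (u x t) i) (outwardNormal Ω x)

/-- `q` is the vector of fluxes `∫_{t₁}^{t₂} ∫_{∂Ω} f_i(u(x, t)) ⬝ ν dS dt` in the sense of traces.
Since `u` is only determined up to null sets of `ℝⁿ × [0, ∞)`, the integral over the single
hypersurface `∂Ω` has no literal meaning. Its meaning is the value at `y = 0` of the Lipschitz
continuous function of `y` which, for almost every small `y`, equals the literal integral over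
the boundary of the parallel set `Ω_y`. -/
def IsBoundaryFlux {n D : ℕ} (f : RVec D → Fin D → RVec n) (u : RVec n → ℝ → RVec D)
    (Ω : Set (RVec n)) (t₁ t₂ : ℝ) (q : RVec D) : Prop :=
  ∃ δ : ℝ, 0 < δ ∧ (∀ y ∈ Ioo (-δ) δ, IsSmoothBounded (parallelSet Ω y)) ∧
    ∃ (H : ℝ → RVec D) (L : NNReal), LipschitzOnWith L H (Ioo (-δ) δ) ∧ H 0 = q ∧
      ∀ᵐ y ∂(volume.restrict (Ioo (-δ) δ)), ∀ i : Fin D,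
        Integrable (fun p : RVec n × ℝ => normalFlux f u (parallelSet Ω y) i p.1 p.2)
          ((surfaceMeasure (parallelSet Ω y)).prod (volume.restrict (Icc t₁ t₂))) ∧
        H y i = ∫ t in t₁..t₂, ∫ x, normalFlux f u (parallelSet Ω y) i x t
          ∂(surfaceMeasure (parallelSet Ω y))

open scoped ENNReal NNReal

/-! Let d be the signed distance to the boundary of Ω, and let m_y(t) be the mass in the part of a
thin tube around that boundary where d < y. Formally, conservation on this region says that the flux
through {d = y} during [t₁,t₂] plus m_y(t₂) − m_y(t₁) is independent of y: it is the inflow across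
the inner edge of the tube. The masses are continuous in t by assumption and Lipschitz in y because
u is bounded, so this one identity yields both the trace and its continuity.

To make it rigorous, the weak form is tested with χ(t)ψ(d(x)) in a single component
(`IsTubularRadius.weak_form`). The layer cake formula turns ∫ψ(d)u into −∫ψ'(y)m_y dy, and the
coarea formula for |∇d| = 1 turns ∫ψ'(d) f·∇d into the integral of ψ'(y) against the literal flux
through {d = y}. The lemma of du Bois-Reymond, used first in t and then in y, shows that flux plus
mass increment is constant for almost every y (`IsTubularRadius.ae_levelFlux_add_eq`). Pairing with
a fixed bump g of integral one evaluates the constant as an increment in time; removing the mass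
increment at level 0 leaves the increment of `fluxPotential`, which is the trace. The trace is
unique because continuous functions that agree almost everywhere near 0 agree at 0.

Two geometric facts are needed. Near the boundary d is smooth with |∇d| = 1
(`eventually_contDiffAt_signedBoundaryDist`), by the inverse function theorem in normal coordinates.
The coarea formula (`IsCompact.measurable_slice_and_lintegral_slice`) follows by carrying level sets
to hyperplanes with maps arbitrarily close to isometries; the accompanying bound on slice areas
controls the volume of thin shells, hence the Lipschitz dependence on y. -/

theorem exists_mem_segment_frontier {E : Type*} [NormedAddCommGroup E] [NormedSpace ℝ E]
    {s : Set E} (hs : IsOpen s) {x z : E} (hx : x ∈ s) (hz : z ∉ s) :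
    ∃ w ∈ segment ℝ x z, w ∈ frontier s := by
  by_contra! h
  have hd : Disjoint (frontier s) (segment ℝ x z) :=
    disjoint_left.2 fun w hw hw' => h w hw' hw
  have hc := isClopen_preimage_val hs hd
  have : PreconnectedSpace (segment ℝ x z) :=
    isPreconnected_iff_preconnectedSpace.1 (convex_segment x z).isPreconnected
  have hu := hc.eq_univ ⟨⟨x, left_mem_segment ℝ x z⟩, hx⟩
  exact hz (hu.ge (mem_univ (⟨z, right_mem_segment ℝ x z⟩ : segment ℝ x z)))

/-! ### The signed distance is 1-Lipschitz and is attained at boundary points. -/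

section SignedDistance

variable {n : ℕ} {Ω : Set (RVec n)}

theorem signedBoundaryDist_of_mem {x : RVec n} (hx : x ∈ Ω) :
    signedBoundaryDist Ω x = -Metric.infDist x Ωᶜ := by
  simp [signedBoundaryDist, Metric.infDist_zero_of_mem hx]

theorem signedBoundaryDist_of_notMem {x : RVec n} (hx : x ∉ Ω) :
    signedBoundaryDist Ω x = Metric.infDist x Ω := by
  simp [signedBoundaryDist, Metric.infDist_zero_of_mem (mem_compl hx)]

theorem signedBoundaryDist_of_mem_frontier (hΩ : IsOpen Ω) {x : RVec n} (hx : x ∈ frontier Ω) :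
    signedBoundaryDist Ω x = 0 := by
  rw [hΩ.frontier_eq] at hx
  rw [signedBoundaryDist_of_notMem hx.2, Metric.infDist_zero_of_mem_closure hx.1]

/-- The segment from `x` to `z` meets the frontier at some `w`, which lies in both `closure Ω` and
`Ωᶜ`. The distances from the endpoints to `w` bound the two terms and add up to `dist z x`. This is
what keeps the Lipschitz constant equal to 1 across the boundary. -/
theorem signedBoundaryDist_sub_le_of_notMem (hΩ : IsOpen Ω) {x z : RVec n} (hx : x ∈ Ω)
    (hz : z ∉ Ω) : signedBoundaryDist Ω z - signedBoundaryDist Ω x ≤ dist z x := by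
  obtain ⟨w, hw, hwf⟩ := exists_mem_segment_frontier hΩ hx hz
  rw [signedBoundaryDist_of_mem hx, signedBoundaryDist_of_notMem hz]
  rw [hΩ.frontier_eq] at hwf
  have h1 := Metric.infDist_le_dist_of_mem (x := z) hwf.1
  rw [Metric.infDist_closure] at h1
  have h2 := Metric.infDist_le_dist_of_mem (x := x) (s := Ωᶜ) hwf.2
  have h3 := dist_add_dist_of_mem_segment hw
  rw [dist_comm z w] at h1
  rw [dist_comm z x]
  linarith

theorem lipschitzWith_signedBoundaryDist (hΩ : IsOpen Ω) :
    LipschitzWith 1 (signedBoundaryDist Ω) := by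
  refine LipschitzWith.of_le_add fun z x => ?_
  have hnn := fun (a : RVec n) (s : Set (RVec n)) => Metric.infDist_nonneg (x := a) (s := s)
  by_cases hx : x ∈ Ω <;> by_cases hz : z ∈ Ω
  · rw [signedBoundaryDist_of_mem hx, signedBoundaryDist_of_mem hz]
    have := Metric.infDist_le_infDist_add_dist (x := x) (y := z) (s := Ωᶜ)
    rw [dist_comm] at this
    linarith
  · linarith [signedBoundaryDist_sub_le_of_notMem hΩ hx hz]
  · rw [signedBoundaryDist_of_mem hz, signedBoundaryDist_of_notMem hx]
    linarith [hnn x Ω, hnn z Ωᶜ, dist_nonneg (x := z) (y := x)]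
  · rw [signedBoundaryDist_of_notMem hx, signedBoundaryDist_of_notMem hz]
    exact Metric.infDist_le_infDist_add_dist

theorem exists_mem_frontier_abs_signedBoundaryDist_eq (hne : Ω.Nonempty) (huniv : Ω ≠ univ)
    (x : RVec n) : ∃ q ∈ frontier Ω, |signedBoundaryDist Ω x| = dist x q := by
  by_cases hx : x ∈ Ω
  · obtain ⟨q, hq, h⟩ := exists_mem_frontier_infDist_compl_eq_dist hx huniv
    exact ⟨q, hq, by rw [signedBoundaryDist_of_mem hx, abs_neg, h, abs_of_nonneg dist_nonneg]⟩
  · obtain ⟨q, hq, h⟩ := exists_mem_frontier_infDist_compl_eq_dist (mem_compl hx)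
      (fun h => by simp [compl_univ_iff] at h; exact hne.ne_empty h)
    rw [frontier_compl] at hq
    rw [compl_compl] at h
    exact ⟨q, hq, by rw [signedBoundaryDist_of_notMem hx, h, abs_of_nonneg dist_nonneg]⟩

end SignedDistance

/-- If the unit vectors differed, their difference `‖w‖⁻¹ • w - ‖a‖⁻¹ • a` would have positive inner
product with `w` and negative inner product with `a`. -/
theorem normalize_eq_of_forall_inner_nonneg {E : Type*} [NormedAddCommGroup E]
    [InnerProductSpace ℝ E] {a w : E} (ha : a ≠ 0) (hw : w ≠ 0)
    (h : ∀ v, 0 < inner ℝ w v → 0 ≤ inner ℝ a v) : ‖a‖⁻¹ • a = ‖w‖⁻¹ • w := by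
  by_contra hne
  have ha' := norm_pos_iff.2 ha
  have hw' := norm_pos_iff.2 hw
  have e1 : ‖‖a‖⁻¹ • a‖ = 1 := norm_smul_inv_norm (𝕜 := ℝ) ha
  have e2 : ‖‖w‖⁻¹ • w‖ = 1 := norm_smul_inv_norm (𝕜 := ℝ) hw
  have hlt : inner ℝ (‖a‖⁻¹ • a) (‖w‖⁻¹ • w) < 1 := (inner_lt_one_iff_real_of_norm_eq_one e1 e2).2 hne
  have h1 : 0 < inner ℝ w (‖w‖⁻¹ • w - ‖a‖⁻¹ • a) := by
    have : w = ‖w‖ • (‖w‖⁻¹ • w) := by rw [smul_smul, mul_inv_cancel₀ hw'.ne', one_smul]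
    conv_rhs => rw [this]
    rw [inner_smul_left, ← this, inner_sub_right, real_inner_self_eq_norm_sq, e2,
      real_inner_comm]
    simp only [conj_trivial]
    apply mul_pos hw'
    linarith
  have h2 : inner ℝ a (‖w‖⁻¹ • w - ‖a‖⁻¹ • a) < 0 := by
    have : a = ‖a‖ • (‖a‖⁻¹ • a) := by rw [smul_smul, mul_inv_cancel₀ ha'.ne', one_smul]
    rw [this, inner_smul_left, ← this, inner_sub_right, real_inner_self_eq_norm_sq, e1]
    simp only [conj_trivial]
    apply mul_neg_of_pos_of_neg ha'
    linarith
  exact absurd (h _ h1) (not_le.2 h2)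

/-! ### Nearest boundary points are reached along the normal. -/

section Smooth

variable {n : ℕ} {Ω : Set (RVec n)}

theorem IsDefiningFunctionAt.eq_zero {p : RVec n} {ρ : RVec n → ℝ} {U : Set (RVec n)}
    (hΩ : IsOpen Ω) (hU : IsOpen U) (hpU : p ∈ U) (hp : p ∈ frontier Ω)
    (hρ : ContinuousOn ρ U) (h : ∀ x ∈ U, x ∈ Ω ↔ ρ x < 0) : ρ p = 0 := by
  rw [hΩ.frontier_eq] at hp
  apply le_antisymm
  · by_contra! hlt
    have := (hρ.continuousAt (hU.mem_nhds hpU)).eventually (lt_mem_nhds hlt)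
    obtain ⟨x, ⟨hx, hx2⟩, hx1⟩ := mem_closure_iff_nhds.1 hp.1 _
      (Filter.inter_mem this (hU.mem_nhds hpU))
    exact lt_asymm hx ((h x hx2).1 hx1)
  · by_contra! hlt
    exact hp.2 ((h p hpU).2 hlt)

/-- If `q` is a nearest boundary point of `x`, then `x - q` is the normal at `q` times the signed
distance of `x`. -/
theorem eq_add_signedBoundaryDist_smul (hΩ : IsOpen Ω) {x q : RVec n} (hq : q ∈ frontier Ω)
    (hd : |signedBoundaryDist Ω x| = dist x q) {ρ : RVec n → ℝ} {U : Set (RVec n)}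
    (hU : IsOpen U) (hqU : q ∈ U) (hρ : ContDiffOn ℝ ∞ ρ U) (hne : gradient ρ q ≠ 0)
    (h : ∀ x ∈ U, x ∈ Ω ↔ ρ x < 0) :
    x = q + signedBoundaryDist Ω x • (‖gradient ρ q‖⁻¹ • gradient ρ q) := by
  have hρq : ρ q = 0 := IsDefiningFunctionAt.eq_zero hΩ hU hqU hq hρ.continuousOn h
  have hdiff : DifferentiableAt ℝ ρ q :=
    (hρ.contDiffAt (hU.mem_nhds hqU)).differentiableAt (by simp)
  rcases eq_or_ne x q with rfl | hxq
  · rw [signedBoundaryDist_of_mem_frontier hΩ hq]; simp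
  have hw : x - q ≠ 0 := sub_ne_zero.2 hxq
  have hline : ∀ v : RVec n, HasDerivAt (fun s : ℝ => q + s • v) v 0 := fun v => by
    simpa using ((hasDerivAt_id (0:ℝ)).smul_const v).const_add q
  have hder : ∀ v : RVec n, HasDerivAt (fun s : ℝ => ρ (q + s • v))
      (inner ℝ (gradient ρ q) v) 0 := fun v => by
    have h2 : HasFDerivAt ρ (InnerProductSpace.toDual ℝ (RVec n) (gradient ρ q))
      (q + (0:ℝ) • v) := by simpa using hdiff.hasGradientAt.hasFDerivAt
    have h3 := h2.comp_hasDerivAt (0:ℝ) (hline v)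
    rw [InnerProductSpace.toDual_apply_apply] at h3
    exact h3
  -- A short move from `q` at an acute angle to `x - q` enters the open ball around `x` of radius
  -- `dist x q`. That ball lies in `Ω` if `x ∈ Ω` and misses `Ω` otherwise, so the sign of `ρ` is
  -- known there and determines the sign of its derivative along `v`. The bound on `s` below is the
  -- condition ‖x − q − s v‖ < ‖x − q‖.
  have hball : ∀ v : RVec n, 0 < inner ℝ (x - q) v →
      ∀ᶠ s in 𝓝[>] (0:ℝ), dist (q + s • v) x < dist x q ∧ q + s • v ∈ U := by
    intro v hv
    have hvn : 0 < ‖v‖ := norm_pos_iff.2 (by rintro rfl; simp at hv)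
    have hU' : ∀ᶠ s in 𝓝[>] (0:ℝ), q + s • v ∈ U := by
      have : Filter.Tendsto (fun s : ℝ => q + s • v) (𝓝 0) (𝓝 q) := by
        simpa using (hline v).continuousAt.tendsto
      exact (this.eventually (hU.mem_nhds hqU)).filter_mono nhdsWithin_le_nhds
    have hsm : ∀ᶠ s in 𝓝[>] (0:ℝ), s < 2 * inner ℝ (x - q) v / ‖v‖ ^ 2 :=
      (gt_mem_nhds (by positivity)).filter_mono nhdsWithin_le_nhds
    filter_upwards [hU', hsm, self_mem_nhdsWithin] with s h1 h2 h3
    refine ⟨?_, h1⟩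
    have hs : 0 < s := h3
    rw [lt_div_iff₀ (by positivity)] at h2
    rw [dist_comm, dist_eq_norm, dist_eq_norm]
    have : x - (q + s • v) = (x - q) - s • v := by abel
    rw [this]
    apply lt_of_pow_lt_pow_left₀ 2 (norm_nonneg _)
    rw [norm_sub_sq_real, real_inner_smul_right, norm_smul, mul_pow, Real.norm_eq_abs, sq_abs]
    nlinarith
  by_cases hx : x ∈ Ω
  · rw [signedBoundaryDist_of_mem hx, abs_neg, abs_of_nonneg Metric.infDist_nonneg] at hd
    have key : ∀ v, 0 < inner ℝ (x - q) v → 0 ≤ inner ℝ (-gradient ρ q) v := by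
      intro v hv
      rw [inner_neg_left, Left.nonneg_neg_iff]
      by_contra! hlt
      have e1 := (hder v).tendsto_slope_zero_right.eventually (lt_mem_nhds hlt)
      obtain ⟨s, h1, ⟨h2, h3⟩, h4⟩ := (e1.and ((hball v hv).and self_mem_nhdsWithin)).exists
      have hs : 0 < s := h4
      have hin : q + s • v ∈ Ω := Metric.ball_infDist_compl_subset (x := x) (by
        rw [Metric.mem_ball, hd]; exact h2)
      have hneg := (h _ h3).1 hin
      simp only [zero_add, zero_smul, add_zero, hρq, sub_zero, smul_eq_mul] at h1
      exact absurd h1 (not_lt.2 (mul_nonpos_of_nonneg_of_nonpos (inv_nonneg.2 hs.le) hneg.le))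
    have := normalize_eq_of_forall_inner_nonneg (neg_ne_zero.2 hne) hw key
    rw [norm_neg, smul_neg, neg_eq_iff_eq_neg] at this
    rw [signedBoundaryDist_of_mem hx, hd, this, smul_neg, neg_smul, neg_neg, dist_eq_norm, smul_smul,
      mul_inv_cancel₀ (norm_ne_zero_iff.2 hw), one_smul]
    abel
  · rw [signedBoundaryDist_of_notMem hx, abs_of_nonneg Metric.infDist_nonneg] at hd
    have key : ∀ v, 0 < inner ℝ (x - q) v → 0 ≤ inner ℝ (gradient ρ q) v := by
      intro v hv
      by_contra! hlt
      have e1 := (hder v).tendsto_slope_zero_right.eventually (gt_mem_nhds hlt)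
      obtain ⟨s, h1, ⟨h2, h3⟩, h4⟩ := (e1.and ((hball v hv).and self_mem_nhdsWithin)).exists
      have hs : 0 < s := h4
      have hin : q + s • v ∉ Ω := Metric.notMem_of_dist_lt_infDist (x := x) (by
        rw [dist_comm, hd]; exact h2)
      have hneg := (not_congr (h _ h3)).1 hin
      simp only [zero_add, zero_smul, add_zero, hρq, sub_zero, smul_eq_mul] at h1
      exact absurd h1 (not_lt.2 (mul_nonneg (inv_nonneg.2 hs.le) (not_lt.1 hneg)))
    have := normalize_eq_of_forall_inner_nonneg hne hw key
    rw [signedBoundaryDist_of_notMem hx, hd, this, dist_eq_norm, smul_smul,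
      mul_inv_cancel₀ (norm_ne_zero_iff.2 hw), one_smul]
    abel

end Smooth

section Gradient

variable {n : ℕ} {ρ : RVec n → ℝ}

theorem ContDiffAt.gradient_right {x : RVec n} (h : ContDiffAt ℝ ∞ ρ x) :
    ContDiffAt ℝ ∞ (gradient ρ) x := by
  have h1 : ContDiffAt ℝ ∞ (fderiv ℝ ρ) x := h.fderiv_right (by simp)
  exact (InnerProductSpace.toDual ℝ (RVec n)).symm.toContinuousLinearEquiv.contDiff.contDiffAt.comp
    x h1

theorem measurable_gradient (ρ : RVec n → ℝ) : Measurable (gradient ρ) :=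
  (InnerProductSpace.toDual ℝ (RVec n)).symm.continuous.measurable.comp (measurable_fderiv ℝ ρ)

end Gradient

/-! ### Smoothness of the signed distance, tubular neighbourhoods and parallel sets. -/

section Smooth

variable {n : ℕ} {Ω : Set (RVec n)}

/-- A nearest point `q` of `x` satisfies dist q p ≤ 2 dist x p, and |d(x)| ≤ dist x p. So the normal
coordinates (q, d(x)) of `x` tend to (p, 0) as `x` tends to `p`, for every choice of nearest point.
-/
theorem eventually_nhds_frontier_of_eventually (hΩ : IsOpen Ω) {p : RVec n} (hp : p ∈ frontier Ω)
    {P : RVec n × ℝ → Prop} (hP : ∀ᶠ z in 𝓝 (p, (0:ℝ)), P z) :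
    ∀ᶠ x in 𝓝 p, ∀ q ∈ frontier Ω, |signedBoundaryDist Ω x| = dist x q →
      P (q, signedBoundaryDist Ω x) := by
  obtain ⟨ε, hε, h⟩ := Metric.eventually_nhds_iff.1 hP
  refine Metric.eventually_nhds_iff.2 ⟨ε / 2, by positivity, fun x hx q hq hd => h ?_⟩
  have h1 : |signedBoundaryDist Ω x| ≤ dist x p := by
    have := (lipschitzWith_signedBoundaryDist hΩ).dist_le_mul x p
    rwa [signedBoundaryDist_of_mem_frontier hΩ hp, Real.dist_eq, sub_zero, NNReal.coe_one,
      one_mul] at this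
  rw [Prod.dist_eq, max_lt_iff]
  constructor
  · calc dist q p ≤ dist q x + dist x p := dist_triangle _ _ _
      _ < ε := by rw [dist_comm q x, ← hd]; linarith
  · rw [Real.dist_eq, sub_zero]
    linarith

/-- The signed distance to a smooth boundary is smooth near the boundary and satisfies the
eikonal equation there. -/
theorem eventually_contDiffAt_signedBoundaryDist (hΩ : IsOpen Ω) (hne : Ω.Nonempty)
    (huniv : Ω ≠ univ) {p : RVec n} (hp : p ∈ frontier Ω) {ρ : RVec n → ℝ}
    (hdef : IsDefiningFunctionAt Ω p ρ) :
    ∀ᶠ x in 𝓝 p, ContDiffAt ℝ ∞ (signedBoundaryDist Ω) x ∧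
      ‖gradient (signedBoundaryDist Ω) x‖ = 1 := by
  obtain ⟨U, hU, hpU, hρ, hgp, hsign⟩ := hdef
  set d := signedBoundaryDist Ω with hd
  let N : RVec n → RVec n := fun q => ‖gradient ρ q‖⁻¹ • gradient ρ q
  -- Normal coordinates (q, s) ↦ q + s N(q), with `q` free in a neighbourhood instead of on the
  -- boundary. The extra component ρ(q) makes the dimensions match and avoids charts of the
  -- boundary, which is the slice where it vanishes.
  let E : RVec n × ℝ → RVec n × ℝ := fun z => (z.1 + z.2 • N z.1, ρ z.1)
  have hρat : ∀ q ∈ U, ContDiffAt ℝ ∞ ρ q := fun q hq => hρ.contDiffAt (hU.mem_nhds hq)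
  have hN : ∀ q ∈ U, gradient ρ q ≠ 0 → ContDiffAt ℝ ∞ N q := fun q hq h0 =>
    (((hρat q hq).gradient_right.norm ℝ h0).inv (norm_ne_zero_iff.2 h0)).smul
      (hρat q hq).gradient_right
  have hE : ∀ z : RVec n × ℝ, z.1 ∈ U → gradient ρ z.1 ≠ 0 → ContDiffAt ℝ ∞ E z := by
    intro z hz h0
    refine ContDiffAt.prodMk ?_ ?_
    · exact contDiffAt_fst.add (contDiffAt_snd.smul ((hN z.1 hz h0).comp z contDiffAt_fst))
    · exact (hρat z.1 hz).comp z contDiffAt_fst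
  -- the derivative of `E` at `(p, 0)`
  let A : RVec n × ℝ →L[ℝ] RVec n × ℝ :=
    (ContinuousLinearMap.fst ℝ (RVec n) ℝ + (ContinuousLinearMap.snd ℝ (RVec n) ℝ).smulRight (N p)).prod
      ((InnerProductSpace.toDual ℝ (RVec n) (gradient ρ p)).comp
        (ContinuousLinearMap.fst ℝ (RVec n) ℝ))
  have hA : HasFDerivAt E A (p, 0) := by
    have h1 : HasFDerivAt (fun z : RVec n × ℝ => N z.1)
        ((fderiv ℝ N p).comp (ContinuousLinearMap.fst ℝ (RVec n) ℝ)) (p, (0:ℝ)) :=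
      HasFDerivAt.comp (g := N) (f := Prod.fst) (p, (0:ℝ))
        ((hN p hpU hgp).differentiableAt (by simp)).hasFDerivAt hasFDerivAt_fst
    have h2 : HasFDerivAt (fun z : RVec n × ℝ => z.2 • N z.1)
        ((ContinuousLinearMap.snd ℝ (RVec n) ℝ).smulRight (N p)) (p, (0:ℝ)) := by
      have := HasFDerivAt.fun_smul (hasFDerivAt_snd (𝕜 := ℝ) (p := (p, (0:ℝ)))) h1
      simpa using this
    have h3 : HasFDerivAt (fun z : RVec n × ℝ => ρ z.1)
        ((InnerProductSpace.toDual ℝ (RVec n) (gradient ρ p)).comp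
        (ContinuousLinearMap.fst ℝ (RVec n) ℝ)) (p, (0:ℝ)) :=
      HasFDerivAt.comp (p, (0:ℝ))
        (((hρat p hpU).differentiableAt (by simp)).hasGradientAt.hasFDerivAt) hasFDerivAt_fst
    exact (hasFDerivAt_fst.add h2).prodMk h3
  have hAinj : Function.Injective A := by
    rw [injective_iff_map_eq_zero]
    rintro ⟨v, s⟩ h
    have h1 : v + s • N p = 0 := congrArg Prod.fst h
    have h2 : inner ℝ (gradient ρ p) v = 0 := congrArg Prod.snd h
    rw [eq_neg_of_add_eq_zero_left h1, inner_neg_right, real_inner_smul_right,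
      real_inner_smul_right, real_inner_self_eq_norm_sq, neg_eq_zero] at h2
    have hpos := norm_pos_iff.2 hgp
    have hs : s = 0 := by
      rcases mul_eq_zero.1 h2 with h | h
      · exact h
      · exact absurd h (by positivity)
    subst hs
    simpa using h1
  let A' : (RVec n × ℝ) ≃L[ℝ] (RVec n × ℝ) :=
    (LinearEquiv.ofInjectiveEndo (A : RVec n × ℝ →ₗ[ℝ] RVec n × ℝ) hAinj).toContinuousLinearEquiv
  have hAA' : (A' : RVec n × ℝ →L[ℝ] RVec n × ℝ) = A := by ext z <;> rfl
  have hstrict : HasStrictFDerivAt E (A' : RVec n × ℝ →L[ℝ] RVec n × ℝ) (p, 0) :=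
    (hE (p, 0) hpU hgp).hasStrictFDerivAt' (by rw [hAA']; exact hA) (by simp)
  let Φ := hstrict.toOpenPartialHomeomorph E
  have hΦ : ∀ z, Φ z = E z := fun z => rfl
  have hgood : ∀ᶠ z : RVec n × ℝ in 𝓝 (p, 0), z.1 ∈ U ∧ gradient ρ z.1 ≠ 0 := by
    have h1 : ∀ᶠ q in 𝓝 p, q ∈ U ∧ gradient ρ q ≠ 0 :=
      (hU.eventually_mem hpU).and
        ((hρat p hpU).gradient_right.continuousAt.eventually_ne hgp)
    exact (continuousAt_fst (p := (p, (0:ℝ)))).eventually h1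
  -- Smoothness of the local inverse is needed at all points (x, 0) near (p, 0), so invertibility of
  -- the derivative must persist nearby.
  have hequiv : ∀ᶠ z in 𝓝 (p, (0:ℝ)), ∃ B : (RVec n × ℝ) ≃L[ℝ] (RVec n × ℝ),
      (B : RVec n × ℝ →L[ℝ] RVec n × ℝ) = fderiv ℝ E z := by
    have h1 : ContinuousAt (fderiv ℝ E) (p, 0) :=
      ((hE (p, 0) hpU hgp).fderiv_right (m := ∞) (by simp)).continuousAt
    have h2 : fderiv ℝ E (p, 0) = A' := hstrict.hasFDerivAt.fderiv
    have h3 := ContinuousLinearEquiv.nhds A'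
    rw [← h2] at h3
    exact h1.eventually h3
  have hsrc : ∀ᶠ z in 𝓝 (p, (0:ℝ)), z ∈ Φ.source :=
    Φ.open_source.eventually_mem hstrict.mem_toOpenPartialHomeomorph_source
  have hnear := eventually_nhds_frontier_of_eventually hΩ hp ((hgood.and hequiv).and hsrc)
  have hexq := exists_mem_frontier_abs_signedBoundaryDist_eq hne huniv
  have hEq : ∀ x q, q ∈ frontier Ω → |d x| = dist x q → q ∈ U → gradient ρ q ≠ 0 →
      E (q, d x) = (x, 0) := by
    intro x q hq hdx hqU hgq
    have h1 := eq_add_signedBoundaryDist_smul hΩ hq hdx hU hqU hρ hgq hsign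
    have h2 := IsDefiningFunctionAt.eq_zero hΩ hU hqU hq hρ.continuousOn hsign
    exact Prod.ext h1.symm h2
  -- Any nearest point `q` gives E(q, d(x)) = (x, 0), so d is a component of the local inverse.
  have hdform : ∀ᶠ x in 𝓝 p, d x = (Φ.symm (x, 0)).2 := by
    filter_upwards [hnear] with x hx
    obtain ⟨q, hq, hdx⟩ := hexq x
    obtain ⟨⟨⟨hqU, hgq⟩, -⟩, hs⟩ := hx q hq hdx
    rw [← hEq x q hq hdx hqU hgq, ← hΦ, Φ.left_inv hs]
  -- along normals the signed distance is the arclength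
  have hray : ∀ᶠ z in 𝓝 (p, (0:ℝ)), z.1 ∈ frontier Ω → d (z.1 + z.2 • N z.1) = z.2 := by
    have hcont : Filter.Tendsto (fun z : RVec n × ℝ => z.1 + z.2 • N z.1) (𝓝 (p, 0)) (𝓝 p) := by
      have := continuous_fst.continuousAt.comp (hE (p, 0) hpU hgp).continuousAt
      have h2 := this.tendsto
      simpa [Function.comp_def, E] using h2
    filter_upwards [hcont.eventually hdform, hsrc, hgood] with z h1 h2 h3 h4
    have h5 : E z = (z.1 + z.2 • N z.1, 0) :=
      Prod.ext rfl (IsDefiningFunctionAt.eq_zero hΩ hU h3.1 h4 hρ.continuousOn hsign)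
    rw [h1, ← h5, ← hΦ, Φ.left_inv h2]
  -- The ray identity is needed on a whole neighbourhood of (q, d(x)), so that it can be
  -- differentiated in `s`.
  have hnear' := eventually_nhds_frontier_of_eventually hΩ hp hray.eventually_nhds
  filter_upwards [hnear, hnear', hdform.eventually_nhds] with x hx hx' hform
  obtain ⟨q, hq, hdx⟩ := hexq x
  obtain ⟨⟨⟨hqU, hgq⟩, B, hB⟩, hs⟩ := hx q hq hdx
  have hEx := hEq x q hq hdx hqU hgq
  have hsymm : Φ.symm (x, 0) = (q, d x) := by rw [← hEx, ← hΦ, Φ.left_inv hs]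
  have htgt : ((x, 0) : RVec n × ℝ) ∈ Φ.target := by rw [← hEx, ← hΦ]; exact Φ.map_source hs
  have hEat := hE (q, d x) hqU hgq
  have hsm : ContDiffAt ℝ ∞ Φ.symm (x, 0) := by
    refine Φ.contDiffAt_symm (f₀' := B) htgt ?_ ?_
    · rw [hsymm, hB]
      exact (hEat.differentiableAt (by simp)).hasFDerivAt
    · rw [hsymm]
      exact hEat
  have hdsm : ContDiffAt ℝ ∞ d x := by
    refine ContDiffAt.congr_of_eventuallyEq ?_ hform
    exact contDiffAt_snd.comp x (hsm.comp x (contDiffAt_id.prodMk contDiffAt_const))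
  -- The norm is at most 1 by the Lipschitz bound, and at least 1 because d has derivative 1 along
  -- the unit normal through `q`.
  refine ⟨hdsm, le_antisymm ?_ ?_⟩
  · have := norm_fderiv_le_of_lipschitz ℝ (x₀ := x) (lipschitzWith_signedBoundaryDist hΩ)
    rw [gradient, LinearIsometryEquiv.norm_map]
    exact_mod_cast this
  · have hNq : ‖N q‖ = 1 := norm_smul_inv_norm (𝕜 := ℝ) hgq
    have hxq : q + d x • N q = x := congrArg Prod.fst hEx
    have h1 : ∀ᶠ s in 𝓝 (d x), d (q + s • N q) = s := by
      have h2 : Filter.Tendsto (fun s : ℝ => (q, s)) (𝓝 (d x)) (𝓝 (q, d x)) :=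
        (Continuous.prodMk_right q).continuousAt
      filter_upwards [h2.eventually (hx' q hq hdx)] with s hs using hs hq
    have h3 : HasDerivAt (fun s : ℝ => q + s • N q) (N q) (d x) := by
      simpa using ((hasDerivAt_id (d x)).smul_const (N q)).const_add q
    have h4 : HasFDerivAt d (InnerProductSpace.toDual ℝ (RVec n) (gradient d x))
        (q + d x • N q) := by
      rw [hxq]; exact (hdsm.differentiableAt (by simp)).hasGradientAt.hasFDerivAt
    have h5 := h4.comp_hasDerivAt (d x) h3
    rw [InnerProductSpace.toDual_apply_apply] at h5
    have h6 : HasDerivAt (fun s : ℝ => d (q + s • N q)) 1 (d x) :=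
      (hasDerivAt_id (d x)).congr_of_eventuallyEq h1
    calc 1 = inner ℝ (gradient d x) (N q) := h6.unique h5
      _ ≤ ‖gradient d x‖ * ‖N q‖ := real_inner_le_norm _ _
      _ = ‖gradient d x‖ := by rw [hNq, mul_one]

theorem IsSmoothBounded.ne_univ (hn : 1 ≤ n) (hΩ : IsSmoothBounded Ω) : Ω ≠ univ := by
  rintro rfl
  have : Nonempty (Fin n) := ⟨⟨0, hn⟩⟩
  exact NormedSpace.unbounded_univ ℝ (RVec n) hΩ.isBounded

/-- A tubular neighbourhood of a smooth boundary. -/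
theorem IsSmoothBounded.exists_tubular (hn : 1 ≤ n) (hΩ : IsSmoothBounded Ω) :
    ∃ δ : ℝ, 0 < δ ∧ (∃ x ∈ Ω, signedBoundaryDist Ω x < -δ) ∧
      ∀ x, |signedBoundaryDist Ω x| ≤ δ → ContDiffAt ℝ ∞ (signedBoundaryDist Ω) x ∧
        ‖gradient (signedBoundaryDist Ω) x‖ = 1 := by
  have hu := hΩ.ne_univ hn
  have hcomp : IsCompact (frontier Ω) :=
    Metric.isCompact_of_isClosed_isBounded isClosed_frontier
      (hΩ.isBounded.closure.subset frontier_subset_closure)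
  let O := interior {x | ContDiffAt ℝ ∞ (signedBoundaryDist Ω) x ∧
        ‖gradient (signedBoundaryDist Ω) x‖ = 1}
  have hO : frontier Ω ⊆ O := by
    intro p hp
    obtain ⟨ρ, hρ⟩ := hΩ.smooth_boundary p hp
    exact mem_interior_iff_mem_nhds.2
      (eventually_contDiffAt_signedBoundaryDist hΩ.isOpen hΩ.nonempty hu hp hρ)
  obtain ⟨r, hr, hsub⟩ := hcomp.exists_thickening_subset_open isOpen_interior hO
  obtain ⟨x₀, hx₀⟩ := hΩ.nonempty
  have hneg : signedBoundaryDist Ω x₀ < 0 := by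
    have := (parallelSet_zero hΩ.isOpen (nonempty_compl.2 hu)).ge hx₀
    exact this
  -- The first bound keeps {|d| ≤ δ} inside the `r`-thickening of the boundary. The second leaves
  -- `x₀` deeper than δ, which keeps the shrunken parallel sets nonempty.
  refine ⟨min (r / 2) (-signedBoundaryDist Ω x₀ / 2), by simp [hr, hneg], ⟨x₀, hx₀, ?_⟩, ?_⟩
  · have := min_le_right (r / 2) (-signedBoundaryDist Ω x₀ / 2)
    linarith
  · intro x hx
    obtain ⟨q, hq, hdx⟩ := exists_mem_frontier_abs_signedBoundaryDist_eq ⟨x₀, hx₀⟩ hu x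
    have hxO : x ∈ O := hsub (Metric.mem_thickening_iff.2 ⟨q, hq, by
      rw [← hdx]
      have := min_le_left (r / 2) (-signedBoundaryDist Ω x₀ / 2)
      linarith⟩)
    have hmem : x ∈ {x | ContDiffAt ℝ ∞ (signedBoundaryDist Ω) x ∧
        ‖gradient (signedBoundaryDist Ω) x‖ = 1} := interior_subset hxO
    exact hmem

theorem isBounded_signedBoundaryDist_le (hΩ : Bornology.IsBounded Ω) (hne : Ω.Nonempty) (r : ℝ) :
    Bornology.IsBounded {x | signedBoundaryDist Ω x ≤ r} := by
  refine (hΩ.thickening (δ := r + 1)).union hΩ |>.subset fun x hx => ?_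
  by_cases hxΩ : x ∈ Ω
  · exact Or.inr hxΩ
  · left
    rw [mem_ofPred_eq, signedBoundaryDist_of_notMem hxΩ] at hx
    exact (Metric.mem_thickening_iff_infDist_lt hne).2 (by linarith)

/-- The signed distance is smooth and satisfies the eikonal equation on `{|d| ≤ δ}`, and `Ω`
contains points at distance more than `δ` from the boundary. -/
structure IsTubularRadius (Ω : Set (RVec n)) (δ : ℝ) : Prop where
  pos : 0 < δ
  deep : ∃ x ∈ Ω, signedBoundaryDist Ω x < -δ
  smooth : ∀ x, |signedBoundaryDist Ω x| ≤ δ → ContDiffAt ℝ ∞ (signedBoundaryDist Ω) x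
  eikonal : ∀ x, |signedBoundaryDist Ω x| ≤ δ → ‖gradient (signedBoundaryDist Ω) x‖ = 1

theorem IsSmoothBounded.exists_isTubularRadius (hn : 1 ≤ n) (hΩ : IsSmoothBounded Ω) :
    ∃ δ : ℝ, IsTubularRadius Ω δ := by
  obtain ⟨δ, h1, h2, h3⟩ := hΩ.exists_tubular hn
  exact ⟨δ, h1, h2, fun x hx => (h3 x hx).1, fun x hx => (h3 x hx).2⟩

variable {δ y : ℝ}

theorem IsTubularRadius.gradient_ne_zero (h : IsTubularRadius Ω δ) {x : RVec n}
    (hx : |signedBoundaryDist Ω x| ≤ δ) : gradient (signedBoundaryDist Ω) x ≠ 0 := by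
  rw [← norm_ne_zero_iff, h.eikonal x hx]
  exact one_ne_zero

/-- A point at level `y` outside the closure of {d < y} would be a local minimum of d, contradicting
the nonvanishing gradient. -/
theorem IsTubularRadius.frontier_parallelSet (h : IsTubularRadius Ω δ) (hΩ : IsOpen Ω)
    (hy : |y| ≤ δ) : frontier (parallelSet Ω y) = {x | signedBoundaryDist Ω x = y} := by
  have hcont := (lipschitzWith_signedBoundaryDist hΩ).continuous
  refine (frontier_lt_subset_eq hcont continuous_const).antisymm fun p hp => ?_
  have hp' : signedBoundaryDist Ω p = y := hp
  have hopen : IsOpen (parallelSet Ω y) := isOpen_lt hcont continuous_const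
  change p ∈ frontier (parallelSet Ω y)
  rw [hopen.frontier_eq]
  refine ⟨?_, fun hlt => (ne_of_lt hlt) hp'⟩
  by_contra hcl
  have hmin : IsLocalMin (signedBoundaryDist Ω) p := by
    have : (closure (parallelSet Ω y))ᶜ ∈ 𝓝 p := isClosed_closure.isOpen_compl.mem_nhds hcl
    filter_upwards [this] with x hx
    rw [hp']
    by_contra! hlt
    exact hx (subset_closure hlt)
  refine h.gradient_ne_zero (x := p) (by rwa [hp']) ?_
  rw [gradient, hmin.fderiv_eq_zero, map_zero]

theorem IsTubularRadius.isDefiningFunctionAt (h : IsTubularRadius Ω δ) (hΩ : IsOpen Ω)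
    (y : ℝ) {p : RVec n} (hp : |signedBoundaryDist Ω p| < δ) :
    IsDefiningFunctionAt (parallelSet Ω y) p (fun x => signedBoundaryDist Ω x - y) ∧
      gradient (fun x => signedBoundaryDist Ω x - y) p = gradient (signedBoundaryDist Ω) p := by
  have hcont := (lipschitzWith_signedBoundaryDist hΩ).continuous
  have hg : gradient (fun x => signedBoundaryDist Ω x - y) p =
      gradient (signedBoundaryDist Ω) p := by
    rw [gradient, gradient, fderiv_sub_const]
  refine ⟨⟨{x | |signedBoundaryDist Ω x| < δ}, isOpen_lt hcont.abs continuous_const, hp, ?_, ?_,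
    fun x _ => (sub_neg (a := signedBoundaryDist Ω x) (b := y)).symm⟩, hg⟩
  · exact fun x hx => ((h.smooth x (le_of_lt hx)).sub contDiffAt_const).contDiffWithinAt
  · rw [hg]
    exact h.gradient_ne_zero hp.le

theorem IsTubularRadius.isSmoothBounded_parallelSet (h : IsTubularRadius Ω δ)
    (hΩ : IsSmoothBounded Ω) (hy : |y| < δ) : IsSmoothBounded (parallelSet Ω y) where
  isOpen := isOpen_lt (lipschitzWith_signedBoundaryDist hΩ.isOpen).continuous continuous_const
  nonempty := by
    obtain ⟨x, -, hx⟩ := h.deep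
    exact ⟨x, hx.trans (abs_lt.1 hy).1⟩
  isBounded := (isBounded_signedBoundaryDist_le hΩ.isBounded hΩ.nonempty y).subset
    fun x (hx : signedBoundaryDist Ω x < y) => mem_ofPred_eq ▸ hx.le
  smooth_boundary := fun p hp => by
    rw [h.frontier_parallelSet hΩ.isOpen hy.le] at hp
    have hp' : signedBoundaryDist Ω p = y := hp
    exact ⟨_, (h.isDefiningFunctionAt hΩ.isOpen y (hp'.symm ▸ hy)).1⟩

theorem IsTubularRadius.outwardNormal_parallelSet (h : IsTubularRadius Ω δ)
    (hΩ : IsSmoothBounded Ω) {p : RVec n} (hp : signedBoundaryDist Ω p = y) (hy : |y| < δ) :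
    outwardNormal (parallelSet Ω y) p = gradient (signedBoundaryDist Ω) p := by
  obtain ⟨h1, h2⟩ := h.isDefiningFunctionAt hΩ.isOpen y (p := p) (hp.symm ▸ hy)
  rw [outwardNormal_eq (h.isSmoothBounded_parallelSet hΩ hy).isOpen _ h1, h2,
    h.eikonal p (hp.symm ▸ hy.le), inv_one, one_smul]
  rw [h.frontier_parallelSet hΩ.isOpen hy.le]
  exact hp

theorem IsSmoothBounded.isCompact_abs_signedBoundaryDist_le (hΩ : IsSmoothBounded Ω) (δ : ℝ) :
    IsCompact {x | |signedBoundaryDist Ω x| ≤ δ} :=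
  Metric.isCompact_of_isClosed_isBounded
    (isClosed_le (lipschitzWith_signedBoundaryDist hΩ.isOpen).continuous.abs continuous_const)
    ((isBounded_signedBoundaryDist_le hΩ.isBounded hΩ.nonempty δ).subset
      fun x (hx : |signedBoundaryDist Ω x| ≤ δ) => mem_ofPred_eq ▸ (le_abs_self _).trans hx)

end Smooth

/-! ### Hausdorff measure of hyperplane slices. -/

section Hausdorff

theorem LipschitzOnWith.euclideanHausdorffMeasure_image_le {X Y : Type*} [EMetricSpace X]
    [EMetricSpace Y] [MeasurableSpace X] [BorelSpace X] [MeasurableSpace Y] [BorelSpace Y]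
    {K : ℝ≥0} {f : X → Y} {s : Set X} (h : LipschitzOnWith K f s) (k : ℕ) :
    μHE[k] (f '' s) ≤ (K : ℝ≥0∞) ^ k * μHE[k] s := by
  have h1 := h.hausdorffMeasure_image_le (d := k) (Nat.cast_nonneg k)
  rw [ENNReal.rpow_natCast] at h1
  simp only [Measure.euclideanHausdorffMeasure_def, Measure.smul_apply, ENNReal.smul_def,
    smul_eq_mul]
  rw [mul_left_comm]
  gcongr

variable {n : ℕ} {e : RVec n}

/-- The isometry w ↦ y e + w parametrizes the hyperplane by the orthogonal complement of `e`, of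
dimension n − 1, where normalized Hausdorff measure is volume. As `y` now enters as a parameter over
a fixed space, measurability and uniform bounds in `y` become accessible. -/
theorem hyperplane_slice_eq_volume (he : ‖e‖ = 1) (t : Set (RVec n)) (y : ℝ) :
    μHE[n - 1] (t ∩ {z | inner ℝ e z = y}) =
      volume ((fun w : (ℝ ∙ e)ᗮ => y • e + (w : RVec n)) ⁻¹' t) := by
  have he0 : e ≠ 0 := norm_ne_zero_iff.1 (by rw [he]; exact one_ne_zero)
  have hrank : Module.finrank ℝ (ℝ ∙ e)ᗮ = n - 1 := by
    have h1 := (ℝ ∙ e).finrank_add_finrank_orthogonal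
    rw [finrank_span_singleton he0, finrank_euclideanSpace_fin] at h1
    omega
  have hiso : Isometry (fun w : (ℝ ∙ e)ᗮ => y • e + (w : RVec n)) :=
    (isometry_add_left (y • e)).comp isometry_subtype_coe
  have hee : inner ℝ e e = 1 := by rw [real_inner_self_eq_norm_sq, he, one_pow]
  rw [← InnerProductSpace.euclideanHausdorffMeasure_eq_volume, hrank,
    ← hiso.euclideanHausdorffMeasure_image, image_preimage_eq_inter_range]
  congr 2
  ext z
  constructor
  · intro hz
    have hz' : inner ℝ e z = y := hz
    refine ⟨⟨z - y • e, Submodule.mem_orthogonal_singleton_iff_inner_right.2 ?_⟩, by simp⟩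
    rw [inner_sub_right, real_inner_smul_right, hee, hz', mul_one, sub_self]
  · rintro ⟨w, rfl⟩
    have := Submodule.mem_orthogonal_singleton_iff_inner_right.1 w.2
    change inner ℝ e (y • e + (w : RVec n)) = y
    rw [inner_add_right, real_inner_smul_right, hee, this, mul_one, add_zero]

theorem measurable_hyperplane_slice (he : ‖e‖ = 1) {t : Set (RVec n)} (ht : MeasurableSet t) :
    Measurable fun y : ℝ => μHE[n - 1] (t ∩ {z | inner ℝ e z = y}) := by
  simp_rw [hyperplane_slice_eq_volume he]
  have hm : Measurable (fun p : ℝ × (ℝ ∙ e)ᗮ => p.1 • e + (p.2 : RVec n)) := by fun_prop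
  exact measurable_measure_prodMk_left (hm ht)

theorem lintegral_hyperplane_slice (he : ‖e‖ = 1) {t : Set (RVec n)} (ht : MeasurableSet t) :
    ∫⁻ y : ℝ, μHE[n - 1] (t ∩ {z | inner ℝ e z = y}) = volume t := by
  have he0 : e ≠ 0 := norm_ne_zero_iff.1 (by rw [he]; exact one_ne_zero)
  have hee : inner ℝ e e = 1 := by rw [real_inner_self_eq_norm_sq, he, one_pow]
  have h := EuclideanGeometry.euclideanHausdorffMeasure_eq_lintegral (0 : RVec n) he0 ht
  rw [InnerProductSpace.euclideanHausdorffMeasure_eq_volume, finrank_euclideanSpace_fin,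
    ← ofReal_norm, he, ENNReal.ofReal_one, one_mul] at h
  rw [h]
  congr 1 with y
  congr 2
  ext z
  simp only [SetLike.mem_coe, AffineSubspace.mem_mk', vsub_eq_sub, vadd_eq_add, add_zero]
  rw [Submodule.mem_orthogonal_singleton_iff_inner_right, inner_sub_right, real_inner_smul_right,
    hee, mul_one, sub_eq_zero]
  rfl

theorem exists_hyperplane_slice_le (he : ‖e‖ = 1) {t : Set (RVec n)}
    (ht : Bornology.IsBounded t) :
    ∃ C : ℝ≥0∞, C ≠ ⊤ ∧ ∀ y : ℝ, μHE[n - 1] (t ∩ {z | inner ℝ e z = y}) ≤ C := by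
  obtain ⟨R, hR⟩ := ht.subset_closedBall 0
  refine ⟨volume (Metric.closedBall (0 : (ℝ ∙ e)ᗮ) R), measure_closedBall_lt_top.ne, fun y => ?_⟩
  rw [hyperplane_slice_eq_volume he]
  refine measure_mono fun w hw => ?_
  have h1 : ‖y • e + (w : RVec n)‖ ≤ R := mem_closedBall_zero_iff.1 (hR hw)
  have h2 : inner ℝ (y • e) (w : RVec n) = 0 := by
    rw [real_inner_smul_left, Submodule.mem_orthogonal_singleton_iff_inner_right.1 w.2, mul_zero]
  have h3 := norm_add_sq_eq_norm_sq_add_norm_sq_of_inner_eq_zero _ _ h2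
  rw [mem_closedBall_zero_iff]
  refine le_trans ?_ h1
  refine (pow_le_pow_iff_left₀ (norm_nonneg _) (norm_nonneg _) two_ne_zero).1 ?_
  rw [Submodule.coe_norm]
  nlinarith [norm_nonneg (y • e)]

end Hausdorff

/-! ### Straightening level sets by near-isometries. -/

section Straighten

variable {n : ℕ}

/-- The map that turns the function `d` into the linear function `⟪e, ·⟫` by moving points in the
direction `e`. -/
noncomputable def straighten (d : RVec n → ℝ) (e x : RVec n) : RVec n :=
  x + (d x - inner ℝ e x) • e

theorem inner_straighten {d : RVec n → ℝ} {e : RVec n} (he : ‖e‖ = 1) (x : RVec n) :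
    inner ℝ e (straighten d e x) = d x := by
  rw [straighten, inner_add_right, real_inner_smul_right, real_inner_self_eq_norm_sq, he]
  ring

/-- Strict differentiability makes d − ⟪e, ·⟫ Lipschitz with constant 1 − K⁻¹ near `p`, hence also
`straighten d e` minus the identity. Distances are therefore multiplied by a factor between K⁻¹ and
2 − K⁻¹ ≤ K. -/
theorem exists_straighten_nearIsometry {d : RVec n → ℝ} {e p : RVec n} (he : ‖e‖ = 1)
    (hd : HasStrictFDerivAt d (InnerProductSpace.toDual ℝ (RVec n) e) p) {K : ℝ≥0} (hK : 1 < K) :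
    ∃ B : Set (RVec n), IsOpen B ∧ p ∈ B ∧ Bornology.IsBounded B ∧
      LipschitzOnWith K (straighten d e) B ∧
      ∀ x ∈ B, ∀ y ∈ B, dist x y ≤ K * dist (straighten d e x) (straighten d e y) := by
  have hK0 : 0 < K := one_pos.trans hK
  have hKi : K⁻¹ < 1 := inv_lt_one_of_one_lt₀ hK
  obtain ⟨s, hs, hs'⟩ := hd.approximates_deriv_on_nhds (c := 1 - K⁻¹)
    (Or.inr (tsub_pos_of_lt hKi))
  obtain ⟨B, hBs, hB, hpB⟩ := mem_nhds_iff.1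
    (Filter.inter_mem hs (Metric.ball_mem_nhds p one_pos))
  have key : ∀ x ∈ B, ∀ y ∈ B,
      ‖(straighten d e x - straighten d e y) - (x - y)‖ ≤ (1 - (K:ℝ)⁻¹) * ‖x - y‖ := by
    intro x hx y hy
    have h1 := hs' x (hBs hx).1 y (hBs hy).1
    rw [NNReal.coe_sub hKi.le, InnerProductSpace.toDual_apply_apply, NNReal.coe_one,
      NNReal.coe_inv] at h1
    have h2 : (straighten d e x - straighten d e y) - (x - y) =
        (d x - d y - inner ℝ e (x - y)) • e := by
      rw [straighten, straighten, inner_sub_right]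
      module
    rw [h2, norm_smul, he, mul_one]
    exact h1
  have hKr : (1:ℝ) < K := by exact_mod_cast hK
  have hKK : (K:ℝ) * (K:ℝ)⁻¹ = 1 := mul_inv_cancel₀ (by positivity)
  refine ⟨B, hB, hpB, Metric.isBounded_ball.subset (hBs.trans inter_subset_right), ?_, ?_⟩
  · refine LipschitzOnWith.of_dist_le_mul fun x hx y hy => ?_
    rw [dist_eq_norm, dist_eq_norm]
    have h1 := key x hx y hy
    have h2 := norm_sub_norm_le (straighten d e x - straighten d e y) (x - y)
    have h3 : 2 - (K:ℝ)⁻¹ ≤ K := by nlinarith [inv_pos.2 (zero_lt_one.trans hKr)]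
    nlinarith [norm_nonneg (x - y)]
  · intro x hx y hy
    rw [dist_eq_norm, dist_eq_norm]
    have h1 := key x hx y hy
    have h2 := norm_sub_norm_le (x - y) (straighten d e x - straighten d e y)
    rw [norm_sub_rev (x - y) (straighten d e x - straighten d e y)] at h2
    have h3 : (K:ℝ)⁻¹ * ‖x - y‖ ≤ ‖straighten d e x - straighten d e y‖ := by linarith
    calc ‖x - y‖ = K * ((K:ℝ)⁻¹ * ‖x - y‖) := by rw [← mul_assoc, hKK, one_mul]
      _ ≤ _ := by gcongr

end Straighten

/-! ### The coarea formula for a function with unit gradient. -/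

section Slices

variable {n : ℕ} {d : RVec n → ℝ}

/-- The areas of the level sets of `d` in `A` integrate to the volume of `A`, up to a factor
`K ^ n`. -/
def HasApproxSlices (d : RVec n → ℝ) (K : ℝ≥0) (A : Set (RVec n)) : Prop :=
  ∃ g : ℝ → ℝ≥0∞, Measurable g ∧
    (∀ y, g y ≤ (K : ℝ≥0∞) ^ n * μHE[n - 1] (A ∩ {x | d x = y})) ∧
    (∀ y, μHE[n - 1] (A ∩ {x | d x = y}) ≤ (K : ℝ≥0∞) ^ n * g y) ∧
    ∫⁻ y, g y ≤ (K : ℝ≥0∞) ^ n * volume A ∧ volume A ≤ (K : ℝ≥0∞) ^ n * ∫⁻ y, g y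

/-- The comparison functions add. Their measurability makes the integrals additive at a stage where
the slice areas themselves are not known to be measurable. -/
theorem HasApproxSlices.union {K : ℝ≥0} {A B : Set (RVec n)} (hd : Measurable d)
    (hA : HasApproxSlices d K A) (hB : HasApproxSlices d K B) (hAB : Disjoint A B)
    (hBm : MeasurableSet B) : HasApproxSlices d K (A ∪ B) := by
  obtain ⟨g, hg, g1, g2, g3, g4⟩ := hA
  obtain ⟨k, hk, k1, k2, k3, k4⟩ := hB
  have hsl : ∀ y, μHE[n - 1] ((A ∪ B) ∩ {x | d x = y}) =
      μHE[n - 1] (A ∩ {x | d x = y}) + μHE[n - 1] (B ∩ {x | d x = y}) := fun y => by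
    rw [union_inter_distrib_right]
    exact measure_union (hAB.mono inter_subset_left inter_subset_left)
      (hBm.inter (hd (measurableSet_singleton y)))
  refine ⟨g + k, hg.add hk, fun y => ?_, fun y => ?_, ?_, ?_⟩
  · rw [hsl, mul_add]; exact add_le_add (g1 y) (k1 y)
  · rw [hsl, Pi.add_apply, mul_add]; exact add_le_add (g2 y) (k2 y)
  · rw [measure_union hAB hBm, mul_add]
    simp only [Pi.add_apply]
    rw [lintegral_add_left hg]
    exact add_le_add g3 k3
  · rw [measure_union hAB hBm]
    simp only [Pi.add_apply]
    rw [lintegral_add_left hg, mul_add]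
    exact add_le_add g4 k4

section NearIsometry

variable {e : RVec n} {K : ℝ≥0} {B : Set (RVec n)}

theorem straighten_injOn
    (hanti : ∀ x ∈ B, ∀ y ∈ B, dist x y ≤ K * dist (straighten d e x) (straighten d e y)) :
    InjOn (straighten d e) B := fun x hx y hy h => by
  have := hanti x hx y hy
  rw [h, dist_self, mul_zero] at this
  exact dist_le_zero.1 this

theorem euclideanHausdorffMeasure_le_straighten_image
    (hanti : ∀ x ∈ B, ∀ y ∈ B, dist x y ≤ K * dist (straighten d e x) (straighten d e y))
    {A : Set (RVec n)} (hA : A ⊆ B) (k : ℕ) :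
    μHE[k] A ≤ (K : ℝ≥0∞) ^ k * μHE[k] (straighten d e '' A) := by
  have hinj := straighten_injOn hanti
  have h1 : LipschitzOnWith K (Function.invFunOn (straighten d e) B) (straighten d e '' A) := by
    refine LipschitzOnWith.of_dist_le_mul ?_
    rintro _ ⟨x, hx, rfl⟩ _ ⟨y, hy, rfl⟩
    rw [hinj.leftInvOn_invFunOn (hA hx), hinj.leftInvOn_invFunOn (hA hy)]
    exact hanti x (hA hx) y (hA hy)
  have h2 := h1.euclideanHausdorffMeasure_image_le k
  rwa [hinj.invFunOn_image hA] at h2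

theorem straighten_image_slice (he : ‖e‖ = 1) (A : Set (RVec n)) (y : ℝ) :
    straighten d e '' (A ∩ {x | d x = y}) = straighten d e '' A ∩ {z | inner ℝ e z = y} := by
  ext z
  constructor
  · rintro ⟨x, ⟨hx, hxy⟩, rfl⟩
    exact ⟨mem_image_of_mem _ hx, (inner_straighten he x).trans hxy⟩
  · rintro ⟨⟨x, hx, rfl⟩, hy⟩
    exact ⟨x, ⟨hx, (inner_straighten he x).symm.trans hy⟩, rfl⟩

/-- The comparison function is the area of the hyperplane slices of the straightened image, to which
Fubini applies exactly. Passing between the set and its image costs K^(n−1) on slices and K^n on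
volumes. -/
theorem hasApproxSlices_of_nearIsometry (he : ‖e‖ = 1) (hK : 1 ≤ K)
    (hlip : LipschitzOnWith K (straighten d e) B)
    (hanti : ∀ x ∈ B, ∀ y ∈ B, dist x y ≤ K * dist (straighten d e x) (straighten d e y))
    {A : Set (RVec n)} (hA : A ⊆ B) (hAm : MeasurableSet A) : HasApproxSlices d K A := by
  have hpow : (K : ℝ≥0∞) ^ (n - 1) ≤ (K : ℝ≥0∞) ^ n :=
    pow_le_pow_right₀ (by exact_mod_cast hK) (Nat.sub_le n 1)
  have himg : MeasurableSet (straighten d e '' A) :=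
    hAm.image_of_continuousOn_injOn (hlip.continuousOn.mono hA)
      ((straighten_injOn hanti).mono hA)
  have hvol : ∀ t : Set (RVec n), μHE[n] t = volume t := fun t => by
    rw [EuclideanSpace.euclideanHausdorffMeasure_eq_volume]
  refine ⟨fun y => μHE[n - 1] (straighten d e '' A ∩ {z | inner ℝ e z = y}),
    measurable_hyperplane_slice he himg, fun y => ?_, fun y => ?_, ?_, ?_⟩
  · beta_reduce
    rw [← straighten_image_slice he]
    refine ((hlip.mono (inter_subset_left.trans hA)).euclideanHausdorffMeasure_image_le _).trans ?_
    gcongr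
  · beta_reduce
    rw [← straighten_image_slice he]
    refine (euclideanHausdorffMeasure_le_straighten_image hanti
      (inter_subset_left.trans hA) _).trans ?_
    gcongr
  · rw [lintegral_hyperplane_slice he himg, ← hvol, ← hvol]
    exact (hlip.mono hA).euclideanHausdorffMeasure_image_le _
  · rw [lintegral_hyperplane_slice he himg, ← hvol, ← hvol]
    exact euclideanHausdorffMeasure_le_straighten_image hanti hA _

end NearIsometry

theorem exists_nhds_hasApproxSlices {p : RVec n} (hd : ContDiffAt ℝ ∞ d p)
    (he : ‖gradient d p‖ = 1) {K : ℝ≥0} (hK : 1 < K) :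
    ∃ B : Set (RVec n), IsOpen B ∧ p ∈ B ∧
      (∀ A ⊆ B, MeasurableSet A → HasApproxSlices d K A) ∧
      ∃ C : ℝ≥0∞, C ≠ ⊤ ∧ ∀ y, μHE[n - 1] (B ∩ {x | d x = y}) ≤ C := by
  have hstrict : HasStrictFDerivAt d (InnerProductSpace.toDual ℝ (RVec n) (gradient d p)) p :=
    hd.hasStrictFDerivAt' (hd.differentiableAt (by simp)).hasGradientAt.hasFDerivAt (by simp)
  obtain ⟨B, hB, hpB, hbd, hlip, hanti⟩ := exists_straighten_nearIsometry he hstrict hK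
  refine ⟨B, hB, hpB, fun A hA hAm => hasApproxSlices_of_nearIsometry he hK.le hlip hanti hA hAm,
    ?_⟩
  have himg : Bornology.IsBounded (straighten d (gradient d p) '' B) := by
    refine Metric.isBounded_image_iff.2 ⟨K * Metric.diam B, fun x hx y hy => ?_⟩
    refine (hlip.dist_le_mul x hx y hy).trans ?_
    gcongr
    exact Metric.dist_le_diam_of_mem hbd hx hy
  obtain ⟨C, hC, h⟩ := exists_hyperplane_slice_le he himg
  refine ⟨(K : ℝ≥0∞) ^ (n - 1) * C, by finiteness, fun y => ?_⟩
  refine (euclideanHausdorffMeasure_le_straighten_image hanti inter_subset_left _).trans ?_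
  rw [straighten_image_slice he]
  gcongr
  exact h y

variable {S : Set (RVec n)}

/-- Finitely many near-isometric patches cover `S`; a subset of their union is cut into disjoint
pieces, one per patch. -/
theorem IsCompact.exists_hasApproxSlices (hS : IsCompact S) (hd : Measurable d)
    (hsm : ∀ x ∈ S, ContDiffAt ℝ ∞ d x) (heik : ∀ x ∈ S, ‖gradient d x‖ = 1) {K : ℝ≥0}
    (hK : 1 < K) : ∃ t, S ⊆ t ∧ MeasurableSet t ∧
      ∀ A ⊆ t, MeasurableSet A → HasApproxSlices d K A := by
  refine hS.induction_on (p := fun s => ∃ t, s ⊆ t ∧ MeasurableSet t ∧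
      ∀ A ⊆ t, MeasurableSet A → HasApproxSlices d K A) ?_ ?_ ?_ ?_
  · refine ⟨∅, subset_rfl, .empty, fun A hA _ => ?_⟩
    rw [subset_empty_iff.1 hA]
    exact ⟨0, measurable_zero, by simp, by simp, by simp, by simp⟩
  · rintro s s' hss' ⟨t, ht, h⟩
    exact ⟨t, hss'.trans ht, h⟩
  · rintro s s' ⟨t, ht, htm, h⟩ ⟨t', ht', htm', h'⟩
    refine ⟨t ∪ t', union_subset_union ht ht', htm.union htm', fun A hA hAm => ?_⟩
    rw [← inter_union_sdiff A t]
    refine HasApproxSlices.union hd (h _ inter_subset_right (hAm.inter htm))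
      (h' _ ?_ (hAm.diff htm)) ?_ (hAm.diff htm)
    · exact fun x hx => (hA hx.1).resolve_left hx.2
    · exact disjoint_left.2 fun x hx hx' => hx'.2 hx.2
  · intro x hx
    obtain ⟨B, hB, hxB, h, -⟩ := exists_nhds_hasApproxSlices (hsm x hx) (heik x hx) hK
    exact ⟨B, mem_nhdsWithin_of_mem_nhds (hB.mem_nhds hxB), B, subset_rfl, hB.measurableSet, h⟩

theorem IsCompact.exists_slice_le (hS : IsCompact S)
    (hsm : ∀ x ∈ S, ContDiffAt ℝ ∞ d x) (heik : ∀ x ∈ S, ‖gradient d x‖ = 1) :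
    ∃ C : ℝ≥0∞, C ≠ ⊤ ∧ ∀ y, μHE[n - 1] (S ∩ {x | d x = y}) ≤ C := by
  refine hS.induction_on (p := fun s => ∃ C : ℝ≥0∞, C ≠ ⊤ ∧ ∀ y,
    μHE[n - 1] (s ∩ {x | d x = y}) ≤ C) ?_ ?_ ?_ ?_
  · exact ⟨0, by simp, by simp⟩
  · rintro s s' hss' ⟨C, hC, h⟩
    exact ⟨C, hC, fun y => (measure_mono (inter_subset_inter_left _ hss')).trans (h y)⟩
  · rintro s s' ⟨C, hC, h⟩ ⟨C', hC', h'⟩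
    refine ⟨C + C', by finiteness, fun y => ?_⟩
    rw [union_inter_distrib_right]
    exact (measure_union_le _ _).trans (add_le_add (h y) (h' y))
  · intro x hx
    obtain ⟨B, hB, hxB, -, h⟩ := exists_nhds_hasApproxSlices (hsm x hx) (heik x hx)
      (K := 2) one_lt_two
    exact ⟨B, mem_nhdsWithin_of_mem_nhds (hB.mem_nhds hxB), h⟩

/-- The coarea formula for functions whose gradient has norm one. -/
theorem IsCompact.measurable_slice_and_lintegral_slice (hS : IsCompact S) (hd : Measurable d)
    (hsm : ∀ x ∈ S, ContDiffAt ℝ ∞ d x) (heik : ∀ x ∈ S, ‖gradient d x‖ = 1)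
    {A : Set (RVec n)} (hA : A ⊆ S) (hAm : MeasurableSet A) :
    (Measurable fun y => μHE[n - 1] (A ∩ {x | d x = y})) ∧
      ∫⁻ y, μHE[n - 1] (A ∩ {x | d x = y}) = volume A := by
  -- The distortion factors `K k` decrease to 1, so the approximate coarea inequalities become an
  -- equality in the limit.
  let K : ℕ → ℝ≥0 := fun k => 1 + 1 / ((k : ℝ≥0) + 1)
  have hK : ∀ k, 1 < K k := fun k => lt_add_of_pos_right _ (by positivity)
  let c : ℕ → ℝ≥0∞ := fun k => (K k : ℝ≥0∞) ^ n
  have hKt : Filter.Tendsto K Filter.atTop (𝓝 1) := by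
    simpa [K] using (tendsto_one_div_add_atTop_nhds_zero_nat (𝕜 := ℝ≥0)).const_add 1
  have hc : Filter.Tendsto c Filter.atTop (𝓝 1) := by
    have h1 : Filter.Tendsto (fun k => ((K k ^ n : ℝ≥0) : ℝ≥0∞)) Filter.atTop (𝓝 ((1 ^ n : ℝ≥0) : ℝ≥0∞)) :=
      ENNReal.tendsto_coe.2 (hKt.pow n)
    simpa [c] using h1
  have hcmul : ∀ a : ℝ≥0∞, Filter.Tendsto (fun k => c k * a) Filter.atTop (𝓝 a) := fun a => by
    simpa using ENNReal.Tendsto.mul_const hc (b := a) (Or.inl one_ne_zero)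
  have happ : ∀ k, HasApproxSlices d (K k) A := fun k => by
    obtain ⟨t, ht, -, h⟩ := hS.exists_hasApproxSlices hd hsm heik (hK k)
    exact h A (hA.trans ht) hAm
  choose g hg g1 g2 g3 g4 using happ
  -- The measurable function `c k * g k` lies between the slice area and `c k ^ 2` times it, so the
  -- slice area is a pointwise limit of measurable functions.
  have hG : Measurable fun y => μHE[n - 1] (A ∩ {x | d x = y}) := by
    refine measurable_of_tendsto_metrizable (f := fun k y => c k * g k y)
      (fun k => (hg k).const_mul _) ?_
    rw [tendsto_pi_nhds]
    intro y
    have hcc : Filter.Tendsto (fun k => c k * (c k * μHE[n - 1] (A ∩ {x | d x = y})))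
        Filter.atTop (𝓝 (μHE[n - 1] (A ∩ {x | d x = y}))) := by
      simp_rw [← mul_assoc]
      have h1 := ENNReal.Tendsto.mul hc (Or.inl one_ne_zero) hc (Or.inl one_ne_zero)
      simpa using ENNReal.Tendsto.mul_const h1 (b := μHE[n - 1] (A ∩ {x | d x = y}))
        (Or.inl (by simp))
    refine tendsto_of_tendsto_of_tendsto_of_le_of_le tendsto_const_nhds hcc
      (fun k => g2 k y) (fun k => ?_)
    exact mul_le_mul_right (g1 k y) _
  refine ⟨hG, le_antisymm ?_ ?_⟩
  · have h1 : ∀ k, ∫⁻ y, μHE[n - 1] (A ∩ {x | d x = y}) ≤ c k * (c k * volume A) := fun k =>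
      calc _ ≤ ∫⁻ y, c k * g k y := lintegral_mono (g2 k)
        _ = c k * ∫⁻ y, g k y := lintegral_const_mul _ (hg k)
        _ ≤ _ := mul_le_mul_right (g3 k) _
    have hcc : Filter.Tendsto (fun k => c k * (c k * volume A)) Filter.atTop (𝓝 (volume A)) := by
      simp_rw [← mul_assoc]
      have h1 := ENNReal.Tendsto.mul hc (Or.inl one_ne_zero) hc (Or.inl one_ne_zero)
      simpa using ENNReal.Tendsto.mul_const h1 (b := volume A) (Or.inl (by simp))
    exact ge_of_tendsto' hcc h1
  · have h1 : ∀ k, volume A ≤ c k * (c k * ∫⁻ y, μHE[n - 1] (A ∩ {x | d x = y})) := fun k =>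
      calc _ ≤ c k * ∫⁻ y, g k y := g4 k
        _ ≤ c k * ∫⁻ y, c k * μHE[n - 1] (A ∩ {x | d x = y}) :=
          mul_le_mul_right (lintegral_mono (g1 k)) _
        _ = _ := by rw [lintegral_const_mul _ hG]
    have hcc : Filter.Tendsto (fun k => c k * (c k * ∫⁻ y, μHE[n - 1] (A ∩ {x | d x = y})))
        Filter.atTop (𝓝 (∫⁻ y, μHE[n - 1] (A ∩ {x | d x = y}))) := by
      simp_rw [← mul_assoc]
      have h1 := ENNReal.Tendsto.mul hc (Or.inl one_ne_zero) hc (Or.inl one_ne_zero)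
      simpa using ENNReal.Tendsto.mul_const h1 (b := ∫⁻ y, μHE[n - 1] (A ∩ {x | d x = y}))
        (Or.inl (by simp))
    exact ge_of_tendsto' hcc h1

end Slices

/-! ### Disintegration of Lebesgue measure along level sets. -/

section Disintegration

open ProbabilityTheory

variable {α β γ E : Type*} [MeasurableSpace α] [MeasurableSpace β] [MeasurableSpace γ]
  [NormedAddCommGroup E] [NormedSpace ℝ E] {μ : Measure α} {κ : Kernel α β} {f : β → E}

theorem MeasureTheory.Integrable.integral_measure_comp [IsSFiniteKernel κ] [SFinite μ]
    (hf : Integrable f (μ.bind κ)) :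
    ∫ x, f x ∂(μ.bind κ) = ∫ y, ∫ x, f x ∂(κ y) ∂μ := by
  rw [Measure.comp_eq_comp_const_apply] at hf ⊢
  rw [Kernel.integral_comp hf, Kernel.const_apply]

theorem MeasureTheory.Integrable.integrable_integral_measure_comp [IsSFiniteKernel κ] [SFinite μ]
    (hf : Integrable f (μ.bind κ)) : Integrable (fun y => ∫ x, f x ∂(κ y)) μ := by
  rw [Measure.comp_eq_comp_const_apply] at hf
  simpa using hf.integral_comp

/-- A null set is enlarged to a measurable one, whose sections in `γ` are null off a null set for
the mixture, hence off a null set for almost every `κ y`. Properties holding almost everywhere on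
tube × time thus descend to almost every level. -/
theorem ae_ae_prod_of_ae_comp_prod {τ : Measure γ} [SFinite τ] {p : β × γ → Prop}
    (h : ∀ᵐ z ∂(μ.bind κ).prod τ, p z) : ∀ᵐ y ∂μ, ∀ᵐ z ∂(κ y).prod τ, p z := by
  obtain ⟨s, hsub, hs, hs0⟩ := exists_measurable_superset_of_null (ae_iff.1 h)
  have h1 := (Measure.measure_prod_null hs).1 hs0
  filter_upwards [Measure.ae_ae_of_ae_comp h1] with y hy
  exact measure_mono_null hsub ((Measure.measure_prod_null hs).2 hy)

end Disintegration

section SliceKernel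

open ProbabilityTheory

variable {n : ℕ} {d : RVec n → ℝ} {S : Set (RVec n)}

/-- Surface measures on the level sets of `d` disintegrate Lebesgue measure. -/
theorem IsCompact.exists_sliceKernel {L : Set (RVec n)} (hL : IsCompact L) (hd : Measurable d)
    (hsm : ∀ x ∈ L, ContDiffAt ℝ ∞ d x) (heik : ∀ x ∈ L, ‖gradient d x‖ = 1) (hSL : S ⊆ L)
    (hS : MeasurableSet S) :
    ∃ κ : Kernel ℝ (RVec n), IsFiniteKernel κ ∧
      (∀ y, κ y = (μHE[n - 1]).restrict (S ∩ {x | d x = y})) ∧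
      (volume : Measure ℝ).bind κ = volume.restrict S := by
  have hlev : ∀ y, MeasurableSet (S ∩ {x | d x = y}) := fun y =>
    hS.inter (hd (measurableSet_singleton y))
  have happ : ∀ (A : Set (RVec n)) (y : ℝ), MeasurableSet A →
      (μHE[n - 1]).restrict (S ∩ {x | d x = y}) A = μHE[n - 1] ((A ∩ S) ∩ {x | d x = y}) :=
    fun A y hA => by rw [Measure.restrict_apply hA, inter_assoc]
  let κ : Kernel ℝ (RVec n) := ⟨fun y => (μHE[n - 1]).restrict (S ∩ {x | d x = y}), by
    refine Measure.measurable_of_measurable_coe _ fun A hA => ?_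
    simp_rw [happ A _ hA]
    exact (hL.measurable_slice_and_lintegral_slice hd hsm heik
      (inter_subset_right.trans hSL) (hA.inter hS)).1⟩
  refine ⟨κ, ?_, fun y => rfl, ?_⟩
  · obtain ⟨C, hC, h⟩ := hL.exists_slice_le hsm heik
    refine ⟨C, hC.lt_top, fun y => ?_⟩
    change (μHE[n - 1]).restrict (S ∩ {x | d x = y}) univ ≤ C
    rw [happ _ _ .univ, univ_inter]
    exact (measure_mono (inter_subset_inter_left _ hSL)).trans (h y)
  · ext A hA
    rw [Measure.bind_apply hA κ.aemeasurable, Measure.restrict_apply hA,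
      ← (hL.measurable_slice_and_lintegral_slice hd hsm heik
        (inter_subset_right.trans hSL) (hA.inter hS)).2]
    exact lintegral_congr fun y => happ A y hA

end SliceKernel

/-! ### Weak derivatives on an interval and the layer cake formula. -/

section Distribution

variable {a b : ℝ}

theorem integrable_mul_of_tsupport_subset {g k : ℝ → ℝ} (hg : Continuous g)
    (hgc : HasCompactSupport g) (hgs : tsupport g ⊆ Ioo a b) (hk : IntegrableOn k (Ioo a b)) :
    Integrable fun y => g y * k y := by
  have hsupp : Function.support (fun y => g y * k y) ⊆ Ioo a b := fun y hy =>
    hgs (subset_tsupport g fun h => hy (by simp [h]))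
  rw [← integrableOn_iff_integrable_of_support_subset hsupp]
  obtain ⟨C, hC⟩ := hg.bounded_above_of_compact_support hgc
  exact hk.bdd_mul hg.aestronglyMeasurable (.of_forall hC)

/-- A smooth function with compact support and integral zero is the derivative of a smooth function
with compact support. -/
theorem exists_primitive_of_integral_eq_zero {g : ℝ → ℝ} (hg : ContDiff ℝ ∞ g)
    (hgc : HasCompactSupport g) (hgs : tsupport g ⊆ Ioo a b) (hg0 : ∫ y, g y = 0) :
    ∃ ψ : ℝ → ℝ, ContDiff ℝ ∞ ψ ∧ HasCompactSupport ψ ∧ tsupport ψ ⊆ Ioo a b ∧ deriv ψ = g := by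
  obtain ⟨a', b', hab, hsub⟩ : ∃ a' b', Icc a' b' ⊆ Ioo a b ∧ tsupport g ⊆ Icc a' b' := by
    rcases (tsupport g).eq_empty_or_nonempty with h | h
    -- For empty support the empty interval `Icc 1 0` is taken, since `sInf` and `sSup` would give
    -- nothing useful.
    · exact ⟨1, 0, by simp, by simp [h]⟩
    · have hc : IsCompact (tsupport g) := hgc
      refine ⟨sInf (tsupport g), sSup (tsupport g), ?_, fun x hx =>
        ⟨csInf_le hc.bddBelow hx, le_csSup hc.bddAbove hx⟩⟩
      exact fun x hx => ⟨(hgs (hc.sInf_mem h)).1.trans_le hx.1,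
        hx.2.trans_lt (hgs (hc.sSup_mem h)).2⟩
  have hout : ∀ y, y ∉ Icc a' b' → g y = 0 := fun y hy =>
    image_eq_zero_of_notMem_tsupport fun h => hy (hsub h)
  have hint : Integrable g := hg.continuous.integrable_of_hasCompactSupport hgc
  let ψ : ℝ → ℝ := fun y => ∫ s in (a' - 1)..y, g s
  have hder : ∀ y, HasDerivAt ψ (g y) y := fun y =>
    hg.continuous.integral_hasStrictDerivAt _ _ |>.hasDerivAt
  have hderiv : deriv ψ = g := funext fun y => (hder y).deriv
  have hψ0 : ∀ y, y ∉ Icc a' b' → ψ y = 0 := by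
    intro y hy
    rw [mem_Icc, not_and_or, not_le, not_le] at hy
    rcases hy with hy | hy
    · refine (intervalIntegral.integral_congr (g := fun _ => (0:ℝ)) fun s hs => hout s ?_).trans
        (by simp)
      have : s < a' := lt_of_le_of_lt hs.2 (max_lt (by linarith) hy)
      exact fun h => absurd h.1 (not_le.2 this)
    · by_cases hab' : a' ≤ b'
      · have h1 : ψ y = ∫ s in Ioc (a' - 1) y, g s :=
          intervalIntegral.integral_of_le (by linarith)
        rw [h1, setIntegral_eq_integral_of_forall_compl_eq_zero, hg0]
        intro s hs
        refine hout s fun h => hs ⟨by linarith [h.1], by linarith [h.2]⟩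
      · refine (intervalIntegral.integral_congr (g := fun _ => (0:ℝ)) fun s hs => hout s ?_).trans
          (by simp)
        exact fun h => hab' (h.1.trans h.2)
  have hts : tsupport ψ ⊆ Icc a' b' := by
    refine closure_minimal (fun y hy => ?_) isClosed_Icc
    by_contra h
    exact hy (hψ0 y h)
  refine ⟨ψ, ?_, isCompact_Icc.of_isClosed_subset (isClosed_tsupport ψ) hts, hts.trans hab, hderiv⟩
  rw [contDiff_infty_iff_deriv]
  exact ⟨fun y => (hder y).differentiableAt, hderiv ▸ hg⟩

/-- The lemma of du Bois-Reymond: a function with weak derivative zero is constant. -/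
theorem ae_eq_integral_mul_of_forall_integral_deriv_mul_eq_zero {k g₀ : ℝ → ℝ}
    (hk : IntegrableOn k (Ioo a b)) (hg₀ : ContDiff ℝ ∞ g₀) (hg₀c : HasCompactSupport g₀)
    (hg₀s : tsupport g₀ ⊆ Ioo a b) (hg₀1 : ∫ y, g₀ y = 1)
    (h : ∀ ψ : ℝ → ℝ, ContDiff ℝ ∞ ψ → HasCompactSupport ψ → tsupport ψ ⊆ Ioo a b →
      ∫ y, deriv ψ y * k y = 0) :
    ∀ᵐ y, y ∈ Ioo a b → k y = ∫ s, g₀ s * k s := by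
  set c := ∫ s, g₀ s * k s with hc
  have hloc : LocallyIntegrableOn (fun y => k y - c) (Ioo a b) :=
    (hk.sub (integrable_const c)).locallyIntegrableOn
  have key := isOpen_Ioo.ae_eq_zero_of_integral_contDiff_smul_eq_zero hloc ?_
  · filter_upwards [key] with y hy hmem
    linarith [hy hmem]
  intro g hg hgc hgs
  -- Subtracting `I * g₀` removes the mean of the test function, so that the difference is the
  -- derivative of an admissible one.
  set I := ∫ y, g y with hI
  have hgi : Integrable g := hg.continuous.integrable_of_hasCompactSupport hgc
  have hg₀i : Integrable g₀ := hg₀.continuous.integrable_of_hasCompactSupport hg₀c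
  have hzs : tsupport (fun y => g y - I * g₀ y) ⊆ tsupport g ∪ tsupport g₀ := by
    refine closure_minimal (fun y hy => ?_) ((isClosed_tsupport g).union (isClosed_tsupport g₀))
    by_contra hn
    rw [mem_union, not_or] at hn
    exact hy (by simp [image_eq_zero_of_notMem_tsupport hn.1,
      image_eq_zero_of_notMem_tsupport hn.2])
  obtain ⟨ψ, hψ, hψc, hψs, hψd⟩ := exists_primitive_of_integral_eq_zero
    (g := fun y => g y - I * g₀ y) (hg.sub (contDiff_const.mul hg₀))
    ((hgc.union hg₀c).of_isClosed_subset (isClosed_tsupport _) hzs)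
    (hzs.trans (union_subset hgs hg₀s))
    (by rw [integral_sub hgi (hg₀i.const_mul I), integral_const_mul, hg₀1, mul_one, sub_self])
  have h0 := h ψ hψ hψc hψs
  have i1 := integrable_mul_of_tsupport_subset hg.continuous hgc hgs hk
  have i2 := integrable_mul_of_tsupport_subset hg₀.continuous hg₀c hg₀s hk
  rw [hψd] at h0
  simp_rw [sub_mul, mul_assoc] at h0
  rw [integral_sub i1 (i2.const_mul I), integral_const_mul, ← hc] at h0
  simp_rw [smul_eq_mul, mul_sub]
  rw [integral_sub i1 (hgi.mul_const c), integral_mul_const, ← hI]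
  exact h0

variable {X : Type*} [MeasurableSpace X] {μ : Measure X} [SFinite μ] {d w : X → ℝ}

theorem aestronglyMeasurable_setIntegral_lt (hd : Measurable d) (hw : Integrable w μ) :
    AEStronglyMeasurable (fun y : ℝ => ∫ x in {x | d x < y}, w x ∂μ) := by
  have hm : MeasurableSet {p : ℝ × X | d p.2 < p.1} :=
    measurableSet_lt (hd.comp measurable_snd) measurable_fst
  have h1 : AEStronglyMeasurable ({p : ℝ × X | d p.2 < p.1}.indicator fun p => w p.2)
      ((volume : Measure ℝ).prod μ) := (hw.1.comp_snd).indicator hm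
  refine h1.integral_prod_right'.congr (.of_forall fun y => ?_)
  exact integral_indicator (f := w) (measurableSet_lt hd measurable_const)

/-- Layer cake formula: integration by parts with respect to the level of `d`. -/
theorem integral_comp_mul_eq_neg_integral_deriv_mul (hd : Measurable d) (hw : Integrable w μ)
    {ψ : ℝ → ℝ} (hψ : ContDiff ℝ 1 ψ) (hψc : HasCompactSupport ψ) :
    ∫ x, ψ (d x) * w x ∂μ = -∫ y, deriv ψ y * ∫ x in {x | d x < y}, w x ∂μ := by
  have hψ' : Continuous (deriv ψ) := hψ.continuous_deriv le_rfl
  have hi : Integrable (deriv ψ) := hψ'.integrable_of_hasCompactSupport hψc.deriv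
  have h1 : ∀ z, ψ z = -∫ y, (Ioi z).indicator (deriv ψ) y := fun z => by
    rw [integral_indicator measurableSet_Ioi, hψc.integral_Ioi_deriv_eq hψ, neg_neg]
  have hm : MeasurableSet {p : X × ℝ | d p.1 < p.2} :=
    measurableSet_lt (hd.comp measurable_fst) measurable_snd
  have hint : Integrable (Function.uncurry fun x y => (Ioi (d x)).indicator (deriv ψ) y * w x)
      (μ.prod volume) := by
    have h2 := (hw.mul_prod hi).indicator hm
    refine h2.congr (.of_forall fun p => ?_)
    obtain ⟨x, y⟩ := p
    by_cases hxy : d x < y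
    · simp [indicator, hxy, mul_comm]
    · simp [indicator, hxy]
  calc ∫ x, ψ (d x) * w x ∂μ
      = ∫ x, -(∫ y, (Ioi (d x)).indicator (deriv ψ) y * w x) ∂μ := by
        congr 1 with x
        rw [integral_mul_const, h1 (d x), neg_mul]
    _ = -∫ x, (∫ y, (Ioi (d x)).indicator (deriv ψ) y * w x) ∂μ := integral_neg _
    _ = -∫ y, (∫ x, (Ioi (d x)).indicator (deriv ψ) y * w x ∂μ) := by
        rw [integral_integral_swap hint]
    _ = _ := by
        congr 2 with y
        rw [← integral_const_mul, ← integral_indicator (measurableSet_lt hd measurable_const)]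
        congr 1 with x
        by_cases hxy : d x < y
        · simp [indicator, hxy]
        · simp [indicator, hxy]

end Distribution

/-! ### Integrating a weak derivative in time. -/

section WeakDerivative

theorem exists_smooth_integral_eq_one {a b : ℝ} (hab : a < b) :
    ∃ g : ℝ → ℝ, ContDiff ℝ ∞ g ∧ HasCompactSupport g ∧ tsupport g ⊆ Ioo a b ∧ ∫ y, g y = 1 := by
  let φ : ContDiffBump ((a + b) / 2) := ⟨(b - a) / 8, (b - a) / 4, by linarith, by linarith⟩
  refine ⟨φ.normed volume, φ.contDiff_normed, φ.hasCompactSupport_normed, ?_, φ.integral_normed⟩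
  rw [φ.tsupport_normed_eq, Real.closedBall_eq_Icc]
  exact Icc_subset_Ioo (by change a < (a + b) / 2 - (b - a) / 4; linarith)
    (by change (a + b) / 2 + (b - a) / 4 < b; linarith)

theorem tsupport_deriv_subset_of_subset {χ : ℝ → ℝ} {s : Set ℝ} (h : tsupport χ ⊆ s) :
    tsupport (deriv χ) ⊆ s :=
  (closure_minimal support_deriv_subset (isClosed_tsupport χ)).trans h

/-- A continuous function with integrable weak derivative is the primitive of it. -/
theorem eq_add_integral_of_forall_integral_deriv_mul_add_eq_zero {T : ℝ} (hT : 0 < T)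
    {M B : ℝ → ℝ} (hM : ContinuousOn M (Icc 0 T)) (hB : IntegrableOn B (Icc 0 T))
    (h : ∀ χ : ℝ → ℝ, ContDiff ℝ ∞ χ → HasCompactSupport χ → tsupport χ ⊆ Ioo 0 T →
      ∫ t in Ioc 0 T, (deriv χ t * M t + χ t * B t) = 0) {t : ℝ} (ht : t ∈ Icc 0 T) :
    M t = M 0 + ∫ s in Ioc 0 t, B s := by
  let P : ℝ → ℝ := fun t => ∫ s in Ioc 0 t, B s
  have hP : ContinuousOn P (Icc 0 T) := intervalIntegral.continuousOn_primitive hB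
  have hk : ContinuousOn (fun t => M t - P t) (Icc 0 T) := hM.sub hP
  have hMi : IntegrableOn M (Ioo 0 T) := hM.integrableOn_Icc.mono_set Ioo_subset_Icc_self
  have hPi : IntegrableOn P (Ioo 0 T) := hP.integrableOn_Icc.mono_set Ioo_subset_Icc_self
  have hB' : IntegrableOn B (Ioc 0 T) := hB.mono_set Ioc_subset_Icc_self
  obtain ⟨g₀, hg, hgc, hgs, hg1⟩ := exists_smooth_integral_eq_one hT
  have key := ae_eq_integral_mul_of_forall_integral_deriv_mul_eq_zero (k := fun t => M t - P t)
    (hMi.sub hPi) hg hgc hgs hg1 ?_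
  · have hae : (fun t => M t - P t) =ᵐ[volume.restrict (Icc 0 T)]
        fun _ => ∫ s, g₀ s * (M s - P s) := by
      rw [← restrict_Ioo_eq_restrict_Icc]
      exact (ae_restrict_iff' measurableSet_Ioo).2 key
    have heq := Measure.eqOn_Icc_of_ae_eq volume hT.ne hae hk continuousOn_const
    have h1 := heq ht
    have h2 := heq (left_mem_Icc.2 hT.le)
    have h3 : P 0 = 0 := by simp [P]
    simp only [h3, sub_zero] at h1 h2
    change M t = M 0 + P t
    linarith
  · intro χ hχ hχc hχs
    have hχ1 : ContDiff ℝ 1 χ := hχ.of_le (by simp)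
    have hχ' : Continuous (deriv χ) := hχ1.continuous_deriv le_rfl
    have hχs' := tsupport_deriv_subset_of_subset hχs
    have i1 := integrable_mul_of_tsupport_subset hχ' hχc.deriv hχs' hMi
    have i2 := integrable_mul_of_tsupport_subset hχ' hχc.deriv hχs' hPi
    have i3 := integrable_mul_of_tsupport_subset hχ.continuous hχc hχs
      (hB.mono_set Ioo_subset_Icc_self)
    have h0 := h χ hχ hχc hχs
    rw [integral_add i1.integrableOn i3.integrableOn] at h0
    -- The layer cake formula with level function `id` is integration by parts: ∫χB = −∫χ'P. The
    -- hypothesis becomes ∫χ'(M − P) = 0.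
    have hlc := integral_comp_mul_eq_neg_integral_deriv_mul (μ := volume.restrict (Ioc 0 T))
      measurable_id hB' hχ1 hχc
    have e1 : ∫ t in Ioc 0 T, deriv χ t * M t = ∫ t, deriv χ t * M t :=
      setIntegral_eq_integral_of_forall_compl_eq_zero fun t ht => by
        rw [image_eq_zero_of_notMem_tsupport fun h => ht (Ioo_subset_Ioc_self (hχs' h)), zero_mul]
    have e2 : ∫ y, deriv χ y * ∫ x in {x | id x < y}, B x ∂(volume.restrict (Ioc 0 T)) =
        ∫ y, deriv χ y * P y := by
      congr 1 with y
      by_cases hy : y ∈ Ioo 0 T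
      · rw [Measure.restrict_restrict (measurableSet_lt measurable_id measurable_const)]
        have : {x | id x < y} ∩ Ioc 0 T = Ioo 0 y := by
          ext x
          simp only [id, mem_inter_iff, mem_ofPred_eq, mem_Ioc, mem_Ioo]
          exact ⟨fun h => ⟨h.2.1, h.1⟩, fun h => ⟨h.2, h.1, (h.2.trans hy.2).le⟩⟩
        rw [this, ← integral_Ioc_eq_integral_Ioo]
      · rw [image_eq_zero_of_notMem_tsupport fun h => hy (hχs' h), zero_mul, zero_mul]
    simp only [id] at hlc e2
    rw [e2] at hlc
    simp_rw [mul_sub]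
    rw [integral_sub i1 i2]
    linarith

end WeakDerivative

/-! ### Mass bounds valid at every time. -/

section Mass

variable {n D : ℕ} {u : RVec n → ℝ → RVec D} {S : Set (RVec n)} {T : ℝ}

theorem IsLocallyBounded.exists_ae_norm_le (hu : IsLocallyBounded u)
    (hSb : Bornology.IsBounded S) (T : ℝ) :
    ∃ C : ℝ, 0 ≤ C ∧ ∀ᵐ p ∂(volume.restrict S).prod (volume.restrict (Icc 0 T)),
      ‖u p.1 p.2‖ ≤ C := by
  obtain ⟨C, hC⟩ := hu (closure S ×ˢ Icc 0 T) (hSb.isCompact_closure.prod isCompact_Icc)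
    (prod_mono (subset_univ _) fun t ht => ht.1)
  refine ⟨max C 0, le_max_right _ _, ?_⟩
  rw [Measure.prod_restrict]
  have h1 := ae_restrict_of_ae_restrict_of_subset (prod_mono subset_closure subset_rfl) hC
  filter_upwards [h1] with p hp using hp.trans (le_max_left _ _)

theorem ae_ae_prod_swap {X Y : Type*} [MeasurableSpace X] [MeasurableSpace Y] {μ : Measure X}
    {ν : Measure Y} [SFinite μ] [SFinite ν] {P : X × Y → Prop} (h : ∀ᵐ p ∂μ.prod ν, P p) :
    ∀ᵐ y ∂ν, ∀ᵐ x ∂μ, P (x, y) :=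
  Measure.ae_ae_of_ae_prod
    ((Measure.measurePreserving_swap (μ := ν) (ν := μ)).quasiMeasurePreserving.ae h)

/-- The bound on u holds at almost every time only; continuity of the masses extends the resulting
estimate to every time. -/
theorem HasContinuousMass.norm_integral_sub_le (hmass : HasContinuousMass u)
    (hSb : Bornology.IsBounded S) {C : ℝ} (hT : 0 < T)
    (hu : ∀ᵐ p ∂(volume.restrict S).prod (volume.restrict (Icc 0 T)), ‖u p.1 p.2‖ ≤ C)
    {V V' : Set (RVec n)} (hV : IsOpen V) (hV' : IsOpen V') (hVV' : V' ⊆ V) (hVS : V ⊆ S)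
    {t : ℝ} (ht : t ∈ Icc 0 T) :
    ‖(∫ x in V, u x t) - ∫ x in V', u x t‖ ≤ C * volume.real (V \ V') := by
  have hVb := hSb.subset hVS
  have hVb' := hVb.subset hVV'
  have hfin : volume (V \ V') ≠ ⊤ := (hVb.subset sdiff_subset).measure_lt_top.ne
  let F : ℝ → ℝ := fun t => ‖(∫ x in V, u x t) - ∫ x in V', u x t‖
  let A := C * volume.real (V \ V')
  have hcont : ContinuousOn F (Icc 0 T) :=
    (((hmass V hV hVb).2.sub (hmass V' hV' hVb').2).norm).mono fun t ht => ht.1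
  -- Written as min(F, A) = F, the inequality is an equality of continuous functions, and such
  -- equalities pass from almost every t to every t.
  have hae : (fun t => min (F t) A) =ᵐ[volume.restrict (Icc 0 T)] F := by
    filter_upwards [ae_ae_prod_swap hu, ae_restrict_mem measurableSet_Icc] with t h1 h2
    refine min_eq_left ?_
    have h3 := (hmass V hV hVb).1 t h2.1
    change ‖(∫ x in V, u x t) - ∫ x in V', u x t‖ ≤ A
    rw [← setIntegral_sdiff hV'.measurableSet h3 hVV']
    refine norm_setIntegral_le_of_norm_le_const_ae hfin.lt_top ?_
    have h4 : ∀ᵐ x ∂volume.restrict S, ‖u x t‖ ≤ C := h1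
    exact ae_restrict_of_ae_restrict_of_subset (sdiff_subset.trans hVS) h4
  have heq := Measure.eqOn_Icc_of_ae_eq volume hT.ne hae
    ((continuous_id.min continuous_const).comp_continuousOn hcont) hcont ht
  exact min_eq_left_iff.1 heq

theorem integral_euclideanSpace_apply {X : Type*} [MeasurableSpace X] {μ : Measure X}
    {F : X → RVec D} (hF : Integrable F μ) (i : Fin D) :
    (∫ x, F x ∂μ) i = ∫ x, F x i ∂μ :=
  ((EuclideanSpace.proj i : RVec D →L[ℝ] ℝ).integral_comp_comm hF).symm

end Mass

/-! ### Testing the weak form with functions of time and signed distance. -/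

section WeakForm

variable {n D : ℕ} {Ω : Set (RVec n)} {δ T : ℝ} {f : RVec D → Fin D → RVec n}
  {u : RVec n → ℝ → RVec D}

/-- The open tube of radius `δ` around the boundary of `Ω`. -/
def boundaryTube (Ω : Set (RVec n)) (δ : ℝ) : Set (RVec n) :=
  {x | |signedBoundaryDist Ω x| < δ}

/-- The component of the `i`-th flux vector in the direction of increasing signed distance. -/
noncomputable def fluxDensity (f : RVec D → Fin D → RVec n) (u : RVec n → ℝ → RVec D)
    (Ω : Set (RVec n)) (i : Fin D) (x : RVec n) (t : ℝ) : ℝ :=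
  inner ℝ (f (u x t) i) (gradient (signedBoundaryDist Ω) x)

theorem IsSmoothBounded.isOpen_boundaryTube (hΩ : IsSmoothBounded Ω) (δ : ℝ) :
    IsOpen (boundaryTube Ω δ) :=
  isOpen_lt (lipschitzWith_signedBoundaryDist hΩ.isOpen).continuous.abs continuous_const

theorem IsSmoothBounded.isBounded_boundaryTube (hΩ : IsSmoothBounded Ω) (δ : ℝ) :
    Bornology.IsBounded (boundaryTube Ω δ) :=
  (hΩ.isCompact_abs_signedBoundaryDist_le δ).isBounded.subset
    fun x (hx : |signedBoundaryDist Ω x| < δ) => mem_ofPred_eq ▸ hx.le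

theorem measurable_signedBoundaryDist (Ω : Set (RVec n)) : Measurable (signedBoundaryDist Ω) :=
  ((Metric.continuous_infDist_pt Ω).sub (Metric.continuous_infDist_pt Ωᶜ)).measurable

theorem aestronglyMeasurable_fluxDensity (hf : Continuous f)
    (hu_meas : AEStronglyMeasurable (Function.uncurry u)
      ((volume : Measure (RVec n × ℝ)).restrict (univ ×ˢ Ici 0))) (S : Set (RVec n)) (i : Fin D)
    (T : ℝ) : AEStronglyMeasurable (Function.uncurry (fluxDensity f u Ω i))
      ((volume.restrict S).prod (volume.restrict (Icc 0 T))) := by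
  have h1 : AEStronglyMeasurable (Function.uncurry u)
      ((volume.restrict S).prod (volume.restrict (Icc 0 T))) := by
    rw [Measure.prod_restrict]
    exact hu_meas.mono_measure (Measure.restrict_mono (prod_mono (subset_univ _)
      fun t ht => ht.1) le_rfl)
  have h2 := ((continuous_apply i).comp hf).comp_aestronglyMeasurable h1
  have h3 : StronglyMeasurable fun p : RVec n × ℝ => gradient (signedBoundaryDist Ω) p.1 :=
    ((measurable_gradient _).comp measurable_fst).stronglyMeasurable
  exact h2.inner h3.aestronglyMeasurable

theorem IsTubularRadius.exists_ae_norm_fluxDensity_le (h : IsTubularRadius Ω δ)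
    (hΩ : IsSmoothBounded Ω) (hf : Continuous f) (hu : IsLocallyBounded u) (i : Fin D) (T : ℝ) :
    ∃ C : ℝ, ∀ᵐ p ∂(volume.restrict (boundaryTube Ω δ)).prod (volume.restrict (Icc 0 T)),
      ‖Function.uncurry (fluxDensity f u Ω i) p‖ ≤ C := by
  obtain ⟨C, -, hC⟩ := hu.exists_ae_norm_le (hΩ.isBounded_boundaryTube δ) T
  obtain ⟨C', hC'⟩ := (isCompact_closedBall (0 : RVec D) C).exists_bound_of_continuousOn
    ((continuous_apply i).comp hf).continuousOn
  have hmem : ∀ᵐ p ∂(volume.restrict (boundaryTube Ω δ)).prod (volume.restrict (Icc 0 T)),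
      p ∈ boundaryTube Ω δ ×ˢ Icc 0 T := by
    rw [Measure.prod_restrict]
    exact ae_restrict_mem ((hΩ.isOpen_boundaryTube δ).measurableSet.prod measurableSet_Icc)
  refine ⟨C', ?_⟩
  filter_upwards [hC, hmem] with p hp hpm
  have hpd : |signedBoundaryDist Ω p.1| < δ := hpm.1
  calc ‖fluxDensity f u Ω i p.1 p.2‖
      ≤ ‖f (u p.1 p.2) i‖ * ‖gradient (signedBoundaryDist Ω) p.1‖ := norm_inner_le_norm _ _
    _ = ‖f (u p.1 p.2) i‖ := by rw [h.eikonal _ hpd.le, mul_one]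
    _ ≤ C' := hC' _ (mem_closedBall_zero_iff.2 hp)

theorem IsTubularRadius.contDiff_comp (h : IsTubularRadius Ω δ) (hΩ : IsSmoothBounded Ω)
    {ψ : ℝ → ℝ} (hψ : ContDiff ℝ ∞ ψ) (hψs : tsupport ψ ⊆ Ioo (-δ) δ) :
    ContDiff ℝ ∞ fun x => ψ (signedBoundaryDist Ω x) := by
  have hcont := (lipschitzWith_signedBoundaryDist hΩ.isOpen).continuous
  rw [contDiff_iff_contDiffAt]
  intro x
  by_cases hx : |signedBoundaryDist Ω x| < δ
  · exact hψ.contDiffAt.comp x (h.smooth x hx.le)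
  · have h1 : (signedBoundaryDist Ω) ⁻¹' (tsupport ψ)ᶜ ∈ 𝓝 x :=
      ((isClosed_tsupport ψ).isOpen_compl.preimage hcont).mem_nhds
        fun hm => hx (abs_lt.2 (hψs hm))
    refine (contDiffAt_const (c := (0:ℝ))).congr_of_eventuallyEq ?_
    filter_upwards [h1] with z hz
    exact image_eq_zero_of_notMem_tsupport hz

/-- The weak formulation for test functions that depend on time and the signed distance only. -/
theorem IsTubularRadius.weak_form (h : IsTubularRadius Ω δ) (hΩ : IsSmoothBounded Ω)
    (hu : IsWeakSolution f u) (i : Fin D) (hT : 0 < T) {ψ χ : ℝ → ℝ} (hψ : ContDiff ℝ ∞ ψ)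
    (hψs : tsupport ψ ⊆ Ioo (-δ) δ) (hχ : ContDiff ℝ ∞ χ) (hχc : HasCompactSupport χ)
    (hχs : tsupport χ ⊆ Ioo 0 T) :
    ∫ t in Ioc 0 T, ∫ x in boundaryTube Ω δ,
      (deriv χ t * (ψ (signedBoundaryDist Ω x) * u x t i) +
        χ t * (deriv ψ (signedBoundaryDist Ω x) * fluxDensity f u Ω i x t)) = 0 := by
  set d := signedBoundaryDist Ω with hd
  have hcont : Continuous d := (lipschitzWith_signedBoundaryDist hΩ.isOpen).continuous
  let e : RVec D := EuclideanSpace.single i 1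
  -- The weak form sums over all components; a test field along one coordinate vector isolates the
  -- law for the `i`-th component.
  let φ : RVec n × ℝ → RVec D := fun p => (χ p.2 * ψ (d p.1)) • e
  have hφ : ContDiff ℝ ∞ φ := by
    have h1 : ContDiff ℝ ∞ fun p : RVec n × ℝ => χ p.2 * ψ (d p.1) :=
      (hχ.comp contDiff_snd).mul ((h.contDiff_comp hΩ hψ hψs).comp contDiff_fst)
    exact h1.smul contDiff_const
  have hsub : tsupport φ ⊆ (d ⁻¹' tsupport ψ) ×ˢ tsupport χ := by
    refine closure_minimal (fun p hp => ?_)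
      (((isClosed_tsupport ψ).preimage hcont).prod (isClosed_tsupport χ))
    by_contra hn
    rw [mem_prod, not_and_or] at hn
    apply hp
    rcases hn with hn | hn
    · have : ψ (d p.1) = 0 := image_eq_zero_of_notMem_tsupport hn
      simp [φ, this]
    · have : χ p.2 = 0 := image_eq_zero_of_notMem_tsupport hn
      simp [φ, this]
  have hφc : HasCompactSupport φ := by
    refine ((hΩ.isCompact_abs_signedBoundaryDist_le δ).prod hχc).of_isClosed_subset
      (isClosed_tsupport φ) (hsub.trans (prod_mono (fun x hx => ?_) subset_rfl))
    have h1 : d x ∈ Ioo (-δ) δ := hψs hx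
    exact (abs_lt.2 h1).le
  have hφs : tsupport φ ⊆ boundaryTube Ω δ ×ˢ Ioo 0 T :=
    hsub.trans (prod_mono (fun x hx => abs_lt.2 (hψs hx)) hχs)
  have hφi : ∀ x t, φ (x, t) i = χ t * ψ (d x) := fun x t => by simp [φ, e]
  have hφj : ∀ j ≠ i, ∀ x t, φ (x, t) j = 0 := fun j hj x t => by simp [φ, e, hj]
  have h0 := hu (boundaryTube Ω δ) 0 T (hΩ.isOpen_boundaryTube δ) (hΩ.isBounded_boundaryTube δ)
    le_rfl hT φ hφ hφc hφs
  rw [Finset.sum_eq_single i (fun j _ hj => ?_) (fun hi => absurd (Finset.mem_univ i) hi)] at h0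
  · rw [intervalIntegral.integral_of_le hT.le] at h0
    refine (integral_congr_ae (.of_forall fun t => ?_)).trans h0
    refine setIntegral_congr_fun (hΩ.isOpen_boundaryTube δ).measurableSet fun x hx => ?_
    have hx' : |d x| < δ := hx
    have hdx : HasGradientAt d (gradient d x) x :=
      ((h.smooth x hx'.le).differentiableAt (by simp)).hasGradientAt
    have hψd : HasDerivAt ψ (deriv ψ (d x)) (d x) :=
      (hψ.differentiable (by simp) (d x)).hasDerivAt
    have hgr : gradient (fun z => φ (z, t) i) x = (χ t * deriv ψ (d x)) • gradient d x := by
      simp_rw [hφi]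
      refine HasGradientAt.gradient ?_
      rw [hasGradientAt_iff_hasFDerivAt, map_smul (InnerProductSpace.toDual ℝ (RVec n)), mul_smul]
      exact (hψd.comp_hasFDerivAt x hdx.hasFDerivAt).const_mul (χ t)
    have hdt : deriv (fun s => φ (x, s) i) t = deriv χ t * ψ (d x) := by
      simp_rw [hφi]
      exact deriv_mul_const ((hχ.differentiable (by simp)) t) _
    beta_reduce
    rw [hgr, hdt, real_inner_smul_right, fluxDensity]
    ring
  · have e1 : ∀ t x, deriv (fun s => φ (x, s) j) t = 0 := fun t x => by
      simp_rw [hφj j hj]; simp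
    have e2 : ∀ t x, gradient (fun z => φ (z, t) j) x = 0 := fun t x => by
      simp_rw [hφj j hj]; exact gradient_fun_const x 0
    simp [e1, e2]

end WeakForm

/-! ### Integrals over tube and time as integrals over levels. -/

section Disintegration

open ProbabilityTheory

variable {α β γ : Type*} [MeasurableSpace α] [MeasurableSpace β] [MeasurableSpace γ]
  {μ : Measure α} {κ : Kernel α β} {τ : Measure γ} {w : β × γ → ℝ}

/-- Fubini is used twice around the disintegration: space is moved outermost to split it into
levels, then time is moved back outside on each level. The second swap requires integrability on
almost every level separately. -/
theorem integrable_and_integral_integral_measure_comp [SFinite μ] [IsFiniteKernel κ]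
    [IsFiniteMeasure τ] [SFinite (μ.bind κ)] (hw : Integrable w ((μ.bind κ).prod τ))
    (hw' : ∀ᵐ y ∂μ, Integrable w ((κ y).prod τ)) :
    Integrable (fun y => ∫ t, ∫ x, w (x, t) ∂(κ y) ∂τ) μ ∧
      ∫ t, ∫ x, w (x, t) ∂(μ.bind κ) ∂τ = ∫ y, ∫ t, ∫ x, w (x, t) ∂(κ y) ∂τ ∂μ := by
  have hswap : ∀ᵐ y ∂μ, ∫ x, ∫ t, w (x, t) ∂τ ∂(κ y) = ∫ t, ∫ x, w (x, t) ∂(κ y) ∂τ := by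
    filter_upwards [hw'] with y hy
    exact integral_integral_swap (f := fun x t => w (x, t)) hy
  have h1 : Integrable (fun x => ∫ t, w (x, t) ∂τ) (μ.bind κ) := hw.integral_prod_left
  refine ⟨h1.integrable_integral_measure_comp.congr hswap, ?_⟩
  rw [← integral_integral_swap (f := fun x t => w (x, t)) hw, h1.integral_measure_comp]
  exact integral_congr_ae hswap

/-- Integration over the level sets of `d` of a function weighted by a function of the level. -/
theorem integral_integral_comp_mul_measure_comp {μ : Measure ℝ} {κ : Kernel ℝ β} {d : β → ℝ}
    [SFinite μ] [IsFiniteKernel κ] [IsFiniteMeasure τ] [SFinite (μ.bind κ)]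
    (hd : Measurable d) (hκ : ∀ y, ∀ᵐ x ∂κ y, d x = y) {g : ℝ → ℝ} (hg : Continuous g)
    {C : ℝ} (hC : ∀ y, ‖g y‖ ≤ C) (hw : Integrable w ((μ.bind κ).prod τ))
    (hw' : ∀ᵐ y ∂μ, Integrable w ((κ y).prod τ)) :
    ∫ t, ∫ x, g (d x) * w (x, t) ∂(μ.bind κ) ∂τ =
      ∫ y, g y * ∫ t, ∫ x, w (x, t) ∂(κ y) ∂τ ∂μ := by
  have hgm : Measurable fun p : β × γ => g (d p.1) :=
    hg.measurable.comp (hd.comp measurable_fst)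
  have hb : ∀ ν : Measure (β × γ), Integrable w ν → Integrable (fun p => g (d p.1) * w p) ν :=
    fun ν hν => hν.bdd_mul hgm.aestronglyMeasurable (.of_forall fun p => hC _)
  rw [(integrable_and_integral_integral_measure_comp (w := fun p => g (d p.1) * w p)
    (hb _ hw) (hw'.mono fun y hy => hb _ hy)).2]
  congr 1 with y
  rw [← integral_const_mul]
  congr 1 with t
  rw [← integral_const_mul]
  refine integral_congr_ae ?_
  filter_upwards [hκ y] with x hx
  rw [hx]

end Disintegration

theorem continuousOn_Ici_of_continuousOn_Icc {E : Type*} [TopologicalSpace E] {F : ℝ → E}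
    (h : ∀ T > 0, ContinuousOn F (Icc 0 T)) : ContinuousOn F (Ici 0) := fun t ht => by
  have ht' : (0:ℝ) ≤ t := ht
  have h1 := h (t + 1) (by linarith) t ⟨ht', by linarith⟩
  refine h1.mono_of_mem_nhdsWithin ?_
  have : Iic (t + 1) ∈ 𝓝 t := Iic_mem_nhds (by linarith)
  exact Filter.inter_mem self_mem_nhdsWithin (mem_nhdsWithin_of_mem_nhds this)

/-! ### The mass below a level. -/

section LevelMass

variable {n D : ℕ} {Ω : Set (RVec n)} {δ T : ℝ} {f : RVec D → Fin D → RVec n}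
  {u : RVec n → ℝ → RVec D}

/-- The mass in the part of the tube around the boundary below the level `y`. -/
noncomputable def levelMass (u : RVec n → ℝ → RVec D) (Ω : Set (RVec n)) (δ y t : ℝ) : RVec D :=
  ∫ x in {x | signedBoundaryDist Ω x < y} ∩ boundaryTube Ω δ, u x t

theorem IsSmoothBounded.isOpen_sublevel (hΩ : IsSmoothBounded Ω) (δ y : ℝ) :
    IsOpen ({x | signedBoundaryDist Ω x < y} ∩ boundaryTube Ω δ) :=
  (isOpen_lt (lipschitzWith_signedBoundaryDist hΩ.isOpen).continuous continuous_const).inter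
    (hΩ.isOpen_boundaryTube δ)

theorem IsSmoothBounded.continuousOn_levelMass (hΩ : IsSmoothBounded Ω)
    (hmass : HasContinuousMass u) (δ y : ℝ) : ContinuousOn (levelMass u Ω δ y) (Ici 0) :=
  (hmass _ (hΩ.isOpen_sublevel δ y)
    ((hΩ.isBounded_boundaryTube δ).subset inter_subset_right)).2

theorem IsSmoothBounded.integrable_tube (hΩ : IsSmoothBounded Ω) (hmass : HasContinuousMass u)
    (δ : ℝ) {t : ℝ} (ht : 0 ≤ t) (i : Fin D) :
    Integrable (fun x => u x t i) (volume.restrict (boundaryTube Ω δ)) :=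
  (EuclideanSpace.proj i : RVec D →L[ℝ] ℝ).integrable_comp
    ((hmass _ (hΩ.isOpen_boundaryTube δ) (hΩ.isBounded_boundaryTube δ)).1 t ht)

theorem IsSmoothBounded.levelMass_apply (hΩ : IsSmoothBounded Ω) (hmass : HasContinuousMass u)
    (δ y : ℝ) {t : ℝ} (ht : 0 ≤ t) (i : Fin D) :
    levelMass u Ω δ y t i = ∫ x in {x | signedBoundaryDist Ω x < y}, u x t i
      ∂(volume.restrict (boundaryTube Ω δ)) := by
  rw [levelMass, integral_euclideanSpace_apply ((hmass _ (hΩ.isOpen_sublevel δ y)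
    ((hΩ.isBounded_boundaryTube δ).subset inter_subset_right)).1 t ht),
    Measure.restrict_restrict (measurableSet_lt (measurable_signedBoundaryDist Ω)
      measurable_const)]

theorem IsSmoothBounded.aestronglyMeasurable_levelMass (hΩ : IsSmoothBounded Ω)
    (hmass : HasContinuousMass u) (δ : ℝ) {t : ℝ} (ht : 0 ≤ t) (i : Fin D) :
    AEStronglyMeasurable (fun y => levelMass u Ω δ y t i) := by
  simp_rw [hΩ.levelMass_apply hmass δ _ ht i]
  exact aestronglyMeasurable_setIntegral_lt (measurable_signedBoundaryDist Ω)
    (hΩ.integrable_tube hmass δ ht i)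

/-- Both bounds are cases of `HasContinuousMass.norm_integral_sub_le`: comparison with the empty set
for the size, and with a lower sublevel set for the increment. -/
theorem IsSmoothBounded.exists_norm_levelMass_sub_le (hΩ : IsSmoothBounded Ω)
    (hmass : HasContinuousMass u) (hu : IsLocallyBounded u) (δ : ℝ) (hT : 0 < T) :
    ∃ C : ℝ, 0 ≤ C ∧ ∀ t ∈ Icc 0 T, (∀ y, ‖levelMass u Ω δ y t‖ ≤ C) ∧
      ∀ y y', y ≤ y' → ‖levelMass u Ω δ y' t - levelMass u Ω δ y t‖ ≤
        C * volume.real (boundaryTube Ω δ ∩ signedBoundaryDist Ω ⁻¹' Ico y y') := by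
  obtain ⟨C, hC0, hC⟩ := hu.exists_ae_norm_le (hΩ.isBounded_boundaryTube δ) T
  have hfin : volume (boundaryTube Ω δ) ≠ ⊤ := (hΩ.isBounded_boundaryTube δ).measure_lt_top.ne
  refine ⟨max C (C * volume.real (boundaryTube Ω δ)), le_max_of_le_left hC0, fun t ht =>
    ⟨fun y => ?_, fun y y' hyy' => ?_⟩⟩
  · have h1 := hmass.norm_integral_sub_le (hΩ.isBounded_boundaryTube δ) hT hC
      (hΩ.isOpen_sublevel δ y) isOpen_empty (empty_subset _) inter_subset_right ht
    rw [setIntegral_empty, sub_zero, sdiff_empty] at h1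
    refine h1.trans (le_trans ?_ (le_max_right _ _))
    gcongr
    exact inter_subset_right
  · have h1 := hmass.norm_integral_sub_le (hΩ.isBounded_boundaryTube δ) hT hC
      (hΩ.isOpen_sublevel δ y') (hΩ.isOpen_sublevel δ y)
      (inter_subset_inter_left _ fun x (hx : signedBoundaryDist Ω x < y) =>
        mem_ofPred_eq ▸ hx.trans_le hyy') inter_subset_right ht
    refine h1.trans ?_
    gcongr
    · exact le_max_left _ _
    · exact measure_ne_top_of_subset inter_subset_left hfin
    · rintro x ⟨⟨hx1, hx2⟩, hx3⟩
      exact ⟨hx2, not_lt.1 fun hlt => hx3 ⟨hlt, hx2⟩, hx1⟩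

theorem IsSmoothBounded.integral_comp_mul_eq_levelMass (hΩ : IsSmoothBounded Ω)
    (hmass : HasContinuousMass u) (δ : ℝ) {t : ℝ} (ht : 0 ≤ t) (i : Fin D) {ψ : ℝ → ℝ}
    (hψ : ContDiff ℝ 1 ψ) (hψc : HasCompactSupport ψ) :
    ∫ x in boundaryTube Ω δ, ψ (signedBoundaryDist Ω x) * u x t i =
      -∫ y, deriv ψ y * levelMass u Ω δ y t i := by
  simp_rw [hΩ.levelMass_apply hmass δ _ ht i]
  exact integral_comp_mul_eq_neg_integral_deriv_mul (measurable_signedBoundaryDist Ω)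
    (hΩ.integrable_tube hmass δ ht i) hψ hψc

/-- Dominated convergence: each level mass is continuous in t, with a bound uniform in the level on
compact time intervals. -/
theorem IsSmoothBounded.continuousOn_integral_mul_levelMass (hΩ : IsSmoothBounded Ω)
    (hmass : HasContinuousMass u) (hu : IsLocallyBounded u) (δ : ℝ) (i : Fin D) {g : ℝ → ℝ}
    (hg : Continuous g) (hgc : HasCompactSupport g) :
    ContinuousOn (fun t => ∫ y, g y * levelMass u Ω δ y t i) (Ici 0) := by
  refine continuousOn_Ici_of_continuousOn_Icc fun T hT => ?_
  obtain ⟨C, hC0, hC⟩ := hΩ.exists_norm_levelMass_sub_le hmass hu δ hT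
  refine continuousOn_of_dominated (bound := fun y => ‖g y‖ * C)
    (fun t ht => hg.aestronglyMeasurable.mul (hΩ.aestronglyMeasurable_levelMass hmass δ ht.1 i))
    (fun t ht => .of_forall fun y => ?_)
    ((hg.integrable_of_hasCompactSupport hgc).norm.mul_const C)
    (.of_forall fun y => ?_)
  · rw [norm_mul]
    gcongr
    exact (PiLp.norm_apply_le _ i).trans ((hC t ht).1 y)
  · exact continuousOn_const.mul ((EuclideanSpace.proj i : RVec D →L[ℝ] ℝ).continuous.comp_continuousOn
      ((hΩ.continuousOn_levelMass hmass δ y).mono fun t ht => ht.1))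

end LevelMass

/-! ### Balance between the flux through a level and the mass below it. -/

section Flux

open ProbabilityTheory

variable {n D : ℕ} {Ω : Set (RVec n)} {δ T : ℝ} {f : RVec D → Fin D → RVec n}
  {u : RVec n → ℝ → RVec D}

/-- The flux density integrated over the tube around the boundary with a weight depending on the
signed distance. -/
noncomputable def weightedFlux (f : RVec D → Fin D → RVec n) (u : RVec n → ℝ → RVec D)
    (Ω : Set (RVec n)) (δ : ℝ) (i : Fin D) (g : ℝ → ℝ) (t : ℝ) : ℝ :=
  ∫ x in boundaryTube Ω δ, g (signedBoundaryDist Ω x) * fluxDensity f u Ω i x t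

theorem integrableOn_weightedFlux {i : Fin D}
    (hw : Integrable (Function.uncurry (fluxDensity f u Ω i))
      ((volume.restrict (boundaryTube Ω δ)).prod (volume.restrict (Icc 0 T))))
    {g : ℝ → ℝ} (hg : Continuous g) (hgc : HasCompactSupport g) :
    IntegrableOn (weightedFlux f u Ω δ i g) (Icc 0 T) := by
  obtain ⟨C, hC⟩ := hg.bounded_above_of_compact_support hgc
  have hgm : Measurable fun p : RVec n × ℝ => g (signedBoundaryDist Ω p.1) :=
    hg.measurable.comp ((measurable_signedBoundaryDist Ω).comp measurable_fst)
  exact (hw.bdd_mul hgm.aestronglyMeasurable (.of_forall fun p => hC _)).integral_prod_right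

/-- The balance law for the weighted mass. -/
theorem IsTubularRadius.integral_mul_levelMass_balance (h : IsTubularRadius Ω δ)
    (hΩ : IsSmoothBounded Ω) (hu : IsWeakSolution f u) (hb : IsLocallyBounded u)
    (hmass : HasContinuousMass u) {i : Fin D} (hT : 0 < T)
    (hw : Integrable (Function.uncurry (fluxDensity f u Ω i))
      ((volume.restrict (boundaryTube Ω δ)).prod (volume.restrict (Icc 0 T))))
    {ψ : ℝ → ℝ} (hψ : ContDiff ℝ ∞ ψ) (hψc : HasCompactSupport ψ)
    (hψs : tsupport ψ ⊆ Ioo (-δ) δ) {t : ℝ} (ht : t ∈ Icc 0 T) :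
    ∫ y, deriv ψ y * levelMass u Ω δ y t i = (∫ y, deriv ψ y * levelMass u Ω δ y 0 i) -
      ∫ s in Ioc 0 t, weightedFlux f u Ω δ i (deriv ψ) s := by
  have hψ1 : ContDiff ℝ 1 ψ := hψ.of_le (by simp)
  have hψ' : Continuous (deriv ψ) := hψ1.continuous_deriv le_rfl
  have hB := integrableOn_weightedFlux hw hψ' hψc.deriv
  have hMeq : ∀ t, 0 ≤ t → ∫ x in boundaryTube Ω δ, ψ (signedBoundaryDist Ω x) * u x t i =
      -∫ y, deriv ψ y * levelMass u Ω δ y t i := fun t ht =>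
    hΩ.integral_comp_mul_eq_levelMass hmass δ ht i hψ1 hψc
  have hM : ContinuousOn (fun t => -∫ y, deriv ψ y * levelMass u Ω δ y t i) (Icc 0 T) :=
    ((hΩ.continuousOn_integral_mul_levelMass hmass hb δ i hψ' hψc.deriv).mono
      fun t ht => ht.1).neg
  -- With M the integral of ψ(d)uᵢ over the tube, the weak form says that M has weak time derivative
  -- `weightedFlux f u Ω δ i (deriv ψ)`.
  have key := eq_add_integral_of_forall_integral_deriv_mul_add_eq_zero hT hM hB ?_ ht
  · simp only at key
    linarith
  · intro χ hχ hχc hχs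
    obtain ⟨C, hC⟩ := hψ.continuous.bounded_above_of_compact_support hψc
    obtain ⟨C', hC'⟩ := hψ'.bounded_above_of_compact_support hψc.deriv
    have hae : ∀ᵐ t ∂volume.restrict (Icc 0 T), Integrable (fun x => fluxDensity f u Ω i x t)
        (volume.restrict (boundaryTube Ω δ)) := hw.prod_left_ae
    refine (integral_congr_ae ?_).trans (h.weak_form hΩ hu i hT hψ hψs hχ hχc hχs)
    filter_upwards [ae_restrict_of_ae_restrict_of_subset Ioc_subset_Icc_self hae,
      ae_restrict_mem measurableSet_Ioc] with t h1 h2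
    have hd := measurable_signedBoundaryDist Ω
    have i1 : Integrable (fun x => ψ (signedBoundaryDist Ω x) * u x t i)
        (volume.restrict (boundaryTube Ω δ)) :=
      (hΩ.integrable_tube hmass δ h2.1.le i).bdd_mul
        (hψ.continuous.measurable.comp hd).aestronglyMeasurable (.of_forall fun x => hC _)
    have i2 : Integrable (fun x => deriv ψ (signedBoundaryDist Ω x) * fluxDensity f u Ω i x t)
        (volume.restrict (boundaryTube Ω δ)) :=
      h1.bdd_mul (hψ'.measurable.comp hd).aestronglyMeasurable (.of_forall fun x => hC' _)
    rw [integral_add (i1.const_mul _) (i2.const_mul _), integral_const_mul, integral_const_mul,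
      hMeq t h2.1.le, weightedFlux]

/-- The literal flux through the level set of level `y`, for a disintegration `κ` of Lebesgue
measure on the tube. -/
noncomputable def levelFlux (f : RVec D → Fin D → RVec n) (u : RVec n → ℝ → RVec D)
    (Ω : Set (RVec n)) (κ : Kernel ℝ (RVec n)) (i : Fin D) (t₁ t₂ y : ℝ) : ℝ :=
  ∫ t in Icc t₁ t₂, ∫ x, fluxDensity f u Ω i x t ∂(κ y)

variable {κ : Kernel ℝ (RVec n)} {t₁ t₂ : ℝ} {i : Fin D}

theorem ae_integrable_level [IsFiniteKernel κ]
    (hκv : (volume : Measure ℝ).bind κ = volume.restrict (boundaryTube Ω δ))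
    (hm : AEStronglyMeasurable (Function.uncurry (fluxDensity f u Ω i))
      ((volume.restrict (boundaryTube Ω δ)).prod (volume.restrict (Icc 0 T))))
    {C : ℝ} (hC : ∀ᵐ p ∂(volume.restrict (boundaryTube Ω δ)).prod (volume.restrict (Icc 0 T)),
      ‖Function.uncurry (fluxDensity f u Ω i) p‖ ≤ C) :
    ∀ᵐ y, Integrable (Function.uncurry (fluxDensity f u Ω i))
      ((κ y).prod (volume.restrict (Icc 0 T))) := by
  rw [← hκv] at hC hm
  filter_upwards [ae_ae_prod_of_ae_comp_prod hC, ae_ae_prod_of_ae_comp_prod hm.ae_eq_mk]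
    with y h1 h2
  refine Integrable.of_bound ⟨_, hm.stronglyMeasurable_mk, h2⟩ C h1

/-- The literal flux differs from the mass balance by a constant, for almost every level. -/
theorem IsTubularRadius.ae_levelFlux_add_eq (h : IsTubularRadius Ω δ)
    (hΩ : IsSmoothBounded Ω) (hu : IsWeakSolution f u) (hb : IsLocallyBounded u)
    (hmass : HasContinuousMass u) [IsFiniteKernel κ]
    (hκ : ∀ y, ∀ᵐ x ∂κ y, signedBoundaryDist Ω x = y)
    (hκv : (volume : Measure ℝ).bind κ = volume.restrict (boundaryTube Ω δ))
    (ht₁ : 0 ≤ t₁) (ht : t₁ ≤ t₂) (hT : t₂ ≤ T) (hT0 : 0 < T)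
    (hw : Integrable (Function.uncurry (fluxDensity f u Ω i))
      ((volume.restrict (boundaryTube Ω δ)).prod (volume.restrict (Icc 0 T))))
    (hw' : ∀ᵐ y, Integrable (Function.uncurry (fluxDensity f u Ω i))
      ((κ y).prod (volume.restrict (Icc 0 T))))
    {g : ℝ → ℝ} (hg : ContDiff ℝ ∞ g) (hgc : HasCompactSupport g)
    (hgs : tsupport g ⊆ Ioo (-δ) δ) (hg1 : ∫ y, g y = 1) :
    ∀ᵐ y, y ∈ Ioo (-δ) δ →
      levelFlux f u Ω κ i t₁ t₂ y + (levelMass u Ω δ y t₂ i - levelMass u Ω δ y t₁ i) =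
        ((∫ t in Ioc 0 t₂, weightedFlux f u Ω δ i g t) + ∫ y, g y * levelMass u Ω δ y t₂ i) -
        ((∫ t in Ioc 0 t₁, weightedFlux f u Ω δ i g t) + ∫ y, g y * levelMass u Ω δ y t₁ i) := by
  have ht₂ : 0 ≤ t₂ := ht₁.trans ht
  have hsub : Icc t₁ t₂ ⊆ Icc 0 T := Icc_subset_Icc ht₁ hT
  have hmono : ∀ ν : Measure (RVec n), [SFinite ν] →
      Integrable (Function.uncurry (fluxDensity f u Ω i)) (ν.prod (volume.restrict (Icc 0 T))) →
      Integrable (Function.uncurry (fluxDensity f u Ω i))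
        (ν.prod (volume.restrict (Icc t₁ t₂))) := fun ν _ hν =>
    hν.mono_measure (Measure.prod_mono le_rfl (Measure.restrict_mono hsub le_rfl))
  have hfin : IsFiniteMeasure (volume.restrict (boundaryTube Ω δ)) :=
    ⟨by rw [Measure.restrict_apply_univ]; exact (hΩ.isBounded_boundaryTube δ).measure_lt_top⟩
  have hw1 := hmono _ hw
  have hw1' := hw'.mono fun y hy => hmono _ hy
  have hsf : SFinite ((volume : Measure ℝ).bind κ) := by rw [hκv]; infer_instance
  have hH : Integrable (levelFlux f u Ω κ i t₁ t₂) :=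
    (integrable_and_integral_integral_measure_comp (by rw [hκv]; exact hw1) hw1').1
  -- the weighted flux is an integral over the levels
  have hB : ∀ g : ℝ → ℝ, Continuous g → HasCompactSupport g →
      (∫ t in Ioc 0 t₂, weightedFlux f u Ω δ i g t) - (∫ t in Ioc 0 t₁, weightedFlux f u Ω δ i g t)
        = ∫ y, g y * levelFlux f u Ω κ i t₁ t₂ y := by
    intro g hg hgc
    obtain ⟨C, hC⟩ := hg.bounded_above_of_compact_support hgc
    have hBi := integrableOn_weightedFlux hw hg hgc
    have e1 := integral_integral_comp_mul_measure_comp (measurable_signedBoundaryDist Ω) hκ hg hC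
      (by rw [hκv]; exact hw1) hw1'
    rw [hκv, integral_Icc_eq_integral_Ioc] at e1
    have e2 : ∫ t in Ioc t₁ t₂, weightedFlux f u Ω δ i g t =
      ∫ y, g y * levelFlux f u Ω κ i t₁ t₂ y := e1
    rw [← e2, ← Ioc_union_Ioc_eq_Ioc ht₁ ht, setIntegral_union (Ioc_disjoint_Ioc_of_le le_rfl)
      measurableSet_Ioc, add_sub_cancel_left]
    · exact hBi.mono_set (Ioc_subset_Icc_self.trans (Icc_subset_Icc_right (ht.trans hT)))
    · exact hBi.mono_set (Ioc_subset_Icc_self.trans hsub)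
  obtain ⟨C, -, hC⟩ := hΩ.exists_norm_levelMass_sub_le hmass hb δ hT0
  have hmi : ∀ t ∈ Icc 0 T, IntegrableOn (fun y => levelMass u Ω δ y t i) (Ioo (-δ) δ) :=
    fun t ht => Integrable.of_bound
      (hΩ.aestronglyMeasurable_levelMass hmass δ ht.1 i).restrict C
      (.of_forall fun y => (PiLp.norm_apply_le _ i).trans ((hC t ht).1 y))
  have hm1 := hmi t₁ ⟨ht₁, ht.trans hT⟩
  have hm2 := hmi t₂ ⟨ht₂, hT⟩
  have hsplit : ∀ g : ℝ → ℝ, Continuous g → HasCompactSupport g → tsupport g ⊆ Ioo (-δ) δ →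
      ∫ y, g y * (levelFlux f u Ω κ i t₁ t₂ y +
        (levelMass u Ω δ y t₂ i - levelMass u Ω δ y t₁ i)) =
      (∫ y, g y * levelFlux f u Ω κ i t₁ t₂ y) +
        ((∫ y, g y * levelMass u Ω δ y t₂ i) - ∫ y, g y * levelMass u Ω δ y t₁ i) := by
    intro g hg hgc hgs
    have j1 := integrable_mul_of_tsupport_subset hg hgc hgs hm1
    have j2 := integrable_mul_of_tsupport_subset hg hgc hgs hm2
    have j3 := integrable_mul_of_tsupport_subset hg hgc hgs hH.integrableOn
    simp_rw [mul_add, mul_sub]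
    have e1 := integral_add j3 (j2.sub j1)
    have e2 := integral_sub j2 j1
    simp only [Pi.sub_apply] at e1
    rw [e1, e2]
  -- Against ψ' the flux term and the mass increment cancel, by the balance law at t₁ and t₂. The
  -- remaining constant is evaluated by pairing with `g`.
  have key := ae_eq_integral_mul_of_forall_integral_deriv_mul_eq_zero
    (k := fun y => levelFlux f u Ω κ i t₁ t₂ y +
      (levelMass u Ω δ y t₂ i - levelMass u Ω δ y t₁ i))
    (hH.integrableOn.add (hm2.sub hm1)) hg hgc hgs hg1 ?_
  · filter_upwards [key] with y hy hymem
    rw [hy hymem, hsplit g hg.continuous hgc hgs, ← hB g hg.continuous hgc]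
    ring
  · intro ψ hψ hψc hψs
    have hψ1 : ContDiff ℝ 1 ψ := hψ.of_le (by simp)
    have hψ' : Continuous (deriv ψ) := hψ1.continuous_deriv le_rfl
    rw [hsplit _ hψ' hψc.deriv (tsupport_deriv_subset_of_subset hψs), ← hB _ hψ' hψc.deriv,
      h.integral_mul_levelMass_balance hΩ hu hb hmass hT0 hw hψ hψc hψs ⟨ht₁, ht.trans hT⟩,
      h.integral_mul_levelMass_balance hΩ hu hb hmass hT0 hw hψ hψc hψs ⟨ht₂, hT⟩]
    ring

end Flux

/-! ### Uniqueness, existence and continuity of the trace. -/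

section Main

open ProbabilityTheory

variable {n D : ℕ} {Ω : Set (RVec n)} {δ T : ℝ} {f : RVec D → Fin D → RVec n}
  {u : RVec n → ℝ → RVec D} {t₁ t₂ : ℝ} {κ : Kernel ℝ (RVec n)}

/-- Traces of the flux are unique. -/
theorem IsBoundaryFlux.unique {q q' : RVec D} (h : IsBoundaryFlux f u Ω t₁ t₂ q)
    (h' : IsBoundaryFlux f u Ω t₁ t₂ q') : q = q' := by
  obtain ⟨δ, hδ, -, H, L, hL, rfl, hH⟩ := h
  obtain ⟨δ', hδ', -, H', L', hL', rfl, hH'⟩ := h'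
  have hs : Ioo (-min δ δ') (min δ δ') ⊆ Ioo (-δ) δ :=
    Ioo_subset_Ioo (neg_le_neg (min_le_left _ _)) (min_le_left _ _)
  have hs' : Ioo (-min δ δ') (min δ δ') ⊆ Ioo (-δ') δ' :=
    Ioo_subset_Ioo (neg_le_neg (min_le_right _ _)) (min_le_right _ _)
  have hae : H =ᵐ[volume.restrict (Ioo (-min δ δ') (min δ δ'))] H' := by
    filter_upwards [ae_restrict_of_ae_restrict_of_subset hs hH,
      ae_restrict_of_ae_restrict_of_subset hs' hH'] with y h1 h2
    ext i
    rw [(h1 i).2, (h2 i).2]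
  have hm : 0 < min δ δ' := lt_min hδ hδ'
  exact Measure.eqOn_open_of_ae_eq hae isOpen_Ioo (hL.continuousOn.mono hs)
    (hL'.continuousOn.mono hs') ⟨by linarith, hm⟩

/-- The shell {y ≤ d < y'} has volume equal to the integral of its slice masses, which vanish
outside [y, y') and are bounded uniformly by `κ.bound`. -/
theorem exists_volume_real_levels_le {S : Set (RVec n)} {d : RVec n → ℝ}
    (hd : Measurable d) [IsFiniteKernel κ] (hκ : ∀ y, ∀ᵐ x ∂κ y, d x = y)
    (hκv : (volume : Measure ℝ).bind κ = volume.restrict S) :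
    ∃ A : ℝ, 0 ≤ A ∧ ∀ y y', y ≤ y' → volume.real (S ∩ d ⁻¹' Ico y y') ≤ A * (y' - y) := by
  refine ⟨κ.bound.toReal, ENNReal.toReal_nonneg, fun y y' hyy' => ?_⟩
  have h1 : volume (S ∩ d ⁻¹' Ico y y') ≤ κ.bound * ENNReal.ofReal (y' - y) := by
    have hm : MeasurableSet (d ⁻¹' Ico y y') := hd measurableSet_Ico
    rw [inter_comm, ← Measure.restrict_apply hm, ← hκv, Measure.bind_apply hm κ.aemeasurable,
      ← Real.volume_Ico, ← setLIntegral_const, ← lintegral_indicator measurableSet_Ico]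
    refine lintegral_mono fun s => ?_
    by_cases hs : s ∈ Ico y y'
    · rw [indicator_of_mem hs]
      exact κ.measure_le_bound s _
    · rw [indicator_of_notMem hs, nonpos_iff_eq_zero]
      refine measure_mono_null (fun x hx => ?_) (hκ s)
      exact fun h => hs (h ▸ hx)
  have h2 := ENNReal.toReal_mono
    (ENNReal.mul_ne_top (Kernel.bound_ne_top κ) ENNReal.ofReal_ne_top) h1
  rwa [ENNReal.toReal_mul, ENNReal.toReal_ofReal (sub_nonneg.2 hyy')] at h2

/-- The level masses are Lipschitz continuous functions of the level. -/
theorem IsSmoothBounded.exists_lipschitzWith_levelMass (hΩ : IsSmoothBounded Ω)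
    (hmass : HasContinuousMass u) (hb : IsLocallyBounded u) [IsFiniteKernel κ]
    (hκ : ∀ y, ∀ᵐ x ∂κ y, signedBoundaryDist Ω x = y)
    (hκv : (volume : Measure ℝ).bind κ = volume.restrict (boundaryTube Ω δ)) {t : ℝ}
    (ht : 0 ≤ t) : ∃ L : ℝ≥0, LipschitzWith L fun y => levelMass u Ω δ y t := by
  obtain ⟨C, hC0, hC⟩ := hΩ.exists_norm_levelMass_sub_le hmass hb δ (T := t + 1) (by linarith)
  obtain ⟨A, hA0, hA⟩ := exists_volume_real_levels_le
    (measurable_signedBoundaryDist Ω) hκ hκv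
  have key : ∀ y y', y ≤ y' →
      ‖levelMass u Ω δ y' t - levelMass u Ω δ y t‖ ≤ C * A * (y' - y) := fun y y' hyy' => by
    refine ((hC t ⟨ht, by linarith⟩).2 y y' hyy').trans ?_
    rw [mul_assoc]
    gcongr
    exact hA y y' hyy'
  refine ⟨(C * A).toNNReal, LipschitzWith.of_dist_le_mul fun y y' => ?_⟩
  rw [dist_eq_norm, Real.dist_eq, Real.coe_toNNReal _ (by positivity)]
  rcases le_total y y' with h | h
  · rw [norm_sub_rev, abs_sub_comm, abs_of_nonneg (sub_nonneg.2 h)]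
    exact key y y' h
  · rw [abs_of_nonneg (sub_nonneg.2 h)]
    exact key y' y h

theorem IsTubularRadius.surfaceMeasure_parallelSet (h : IsTubularRadius Ω δ)
    (hΩ : IsSmoothBounded Ω) {y : ℝ} (hy : y ∈ Ioo (-δ) δ) :
    surfaceMeasure (parallelSet Ω y) =
      (μHE[n - 1]).restrict (boundaryTube Ω δ ∩ {x | signedBoundaryDist Ω x = y}) := by
  have hy' : |y| < δ := abs_lt.2 hy
  rw [surfaceMeasure, h.frontier_parallelSet hΩ.isOpen hy'.le]
  congr 1
  refine (inter_eq_right.2 fun x (hx : signedBoundaryDist Ω x = y) => ?_).symm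
  change |signedBoundaryDist Ω x| < δ
  rwa [hx]

/-- A primitive in time of the flux through the boundary. -/
noncomputable def fluxPotential (f : RVec D → Fin D → RVec n) (u : RVec n → ℝ → RVec D)
    (Ω : Set (RVec n)) (δ : ℝ) (g : ℝ → ℝ) (i : Fin D) (t : ℝ) : ℝ :=
  (∫ s in Ioc 0 t, weightedFlux f u Ω δ i g s) + (∫ y, g y * levelMass u Ω δ y t i) -
    levelMass u Ω δ 0 t i

theorem IsSmoothBounded.continuousOn_fluxPotential (hΩ : IsSmoothBounded Ω)
    (hmass : HasContinuousMass u) (hb : IsLocallyBounded u) {i : Fin D}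
    (hw : ∀ T, Integrable (Function.uncurry (fluxDensity f u Ω i))
      ((volume.restrict (boundaryTube Ω δ)).prod (volume.restrict (Icc 0 T))))
    {g : ℝ → ℝ} (hg : Continuous g) (hgc : HasCompactSupport g) :
    ContinuousOn (fluxPotential f u Ω δ g i) (Ici 0) := by
  refine ContinuousOn.sub (ContinuousOn.add ?_ ?_) ?_
  · exact continuousOn_Ici_of_continuousOn_Icc fun T _ =>
      intervalIntegral.continuousOn_primitive (integrableOn_weightedFlux (hw T) hg hgc)
  · exact hΩ.continuousOn_integral_mul_levelMass hmass hb δ i hg hgc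
  · exact (EuclideanSpace.proj i : RVec D →L[ℝ] ℝ).continuous.comp_continuousOn
      (hΩ.continuousOn_levelMass hmass δ 0)

/-- On almost every level the surface measure is `κ y` and the outward normal is ∇d, so the literal
flux is `levelFlux`, which the balance expresses through Lipschitz level masses. -/
theorem IsTubularRadius.isBoundaryFlux (h : IsTubularRadius Ω δ)
    (hΩ : IsSmoothBounded Ω) (hu : IsWeakSolution f u) (hb : IsLocallyBounded u)
    (hmass : HasContinuousMass u) [IsFiniteKernel κ]
    (hκ : ∀ y, κ y = (μHE[n - 1]).restrict (boundaryTube Ω δ ∩ {x | signedBoundaryDist Ω x = y}))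
    (hκv : (volume : Measure ℝ).bind κ = volume.restrict (boundaryTube Ω δ))
    (ht₁ : 0 ≤ t₁) (ht : t₁ ≤ t₂)
    (hw : ∀ i T, Integrable (Function.uncurry (fluxDensity f u Ω i))
      ((volume.restrict (boundaryTube Ω δ)).prod (volume.restrict (Icc 0 T))))
    (hw' : ∀ i T, ∀ᵐ y, Integrable (Function.uncurry (fluxDensity f u Ω i))
      ((κ y).prod (volume.restrict (Icc 0 T))))
    {g : ℝ → ℝ} (hg : ContDiff ℝ ∞ g) (hgc : HasCompactSupport g)
    (hgs : tsupport g ⊆ Ioo (-δ) δ) (hg1 : ∫ y, g y = 1) :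
    IsBoundaryFlux f u Ω t₁ t₂ (WithLp.toLp 2 fun i =>
      fluxPotential f u Ω δ g i t₂ - fluxPotential f u Ω δ g i t₁) := by
  have hcont := (lipschitzWith_signedBoundaryDist hΩ.isOpen).continuous
  have hlev : ∀ y, MeasurableSet (boundaryTube Ω δ ∩ {x | signedBoundaryDist Ω x = y}) :=
    fun y => (hΩ.isOpen_boundaryTube δ).measurableSet.inter
      (isClosed_eq hcont continuous_const).measurableSet
  have hκd : ∀ y, ∀ᵐ x ∂κ y, signedBoundaryDist Ω x = y := fun y => by
    rw [hκ y]
    filter_upwards [ae_restrict_mem (hlev y)] with x hx using hx.2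
  have ht₂ : 0 ≤ t₂ := ht₁.trans ht
  obtain ⟨L₁, hL₁⟩ := hΩ.exists_lipschitzWith_levelMass hmass hb hκd hκv ht₁
  obtain ⟨L₂, hL₂⟩ := hΩ.exists_lipschitzWith_levelMass hmass hb hκd hκv ht₂
  set q : RVec D := WithLp.toLp 2 fun i =>
      fluxPotential f u Ω δ g i t₂ - fluxPotential f u Ω δ g i t₁ with hq
  -- The representative is the constant of the balance law minus the mass increment at level `y`;
  -- the constant is written so that the value at 0 is visibly `q`.
  refine ⟨δ, h.pos, fun y hy => h.isSmoothBounded_parallelSet hΩ (abs_lt.2 hy),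
    fun y => q + (levelMass u Ω δ 0 t₂ - levelMass u Ω δ 0 t₁) -
      (levelMass u Ω δ y t₂ - levelMass u Ω δ y t₁), L₂ + L₁, ?_, by simp, ?_⟩
  · have hconst : LipschitzWith 0 fun _ : ℝ =>
        q + (levelMass u Ω δ 0 t₂ - levelMass u Ω δ 0 t₁) := LipschitzWith.const _
    have := hconst.sub (hL₂.sub hL₁)
    rw [zero_add] at this
    exact this.lipschitzOnWith
  · have hae : ∀ᵐ y, ∀ i : Fin D, (y ∈ Ioo (-δ) δ →
      levelFlux f u Ω κ i t₁ t₂ y + (levelMass u Ω δ y t₂ i - levelMass u Ω δ y t₁ i) =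
        ((∫ t in Ioc 0 t₂, weightedFlux f u Ω δ i g t) + ∫ y, g y * levelMass u Ω δ y t₂ i) -
        ((∫ t in Ioc 0 t₁, weightedFlux f u Ω δ i g t) + ∫ y, g y * levelMass u Ω δ y t₁ i)) ∧
        Integrable (Function.uncurry (fluxDensity f u Ω i))
          ((κ y).prod (volume.restrict (Icc 0 (t₂ + 1)))) := by
      refine ae_all_iff.2 fun i => ?_
      -- The horizon t₂ + 1 is positive even when t₂ = 0.
      exact (h.ae_levelFlux_add_eq hΩ hu hb hmass hκd hκv ht₁ ht (T := t₂ + 1) (by linarith)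
        (by linarith) (hw i _) (hw' i _) hg hgc hgs hg1).and (hw' i _)
    filter_upwards [ae_restrict_of_ae hae, ae_restrict_mem measurableSet_Ioo] with y hy hymem i
    obtain ⟨h1, h2⟩ := hy i
    have h3 := h1 hymem
    have hsurf : surfaceMeasure (parallelSet Ω y) = κ y := by
      rw [hκ y, h.surfaceMeasure_parallelSet hΩ hymem]
    have hnormal : ∀ᵐ x ∂κ y, ∀ t, fluxDensity f u Ω i x t =
        normalFlux f u (parallelSet Ω y) i x t := by
      filter_upwards [hκd y] with x hx t
      rw [normalFlux, h.outwardNormal_parallelSet hΩ hx (abs_lt.2 hymem), fluxDensity]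
    rw [hsurf]
    constructor
    · have h4 : Integrable (Function.uncurry (fluxDensity f u Ω i))
          ((κ y).prod (volume.restrict (Icc t₁ t₂))) :=
        h2.mono_measure (Measure.prod_mono le_rfl (Measure.restrict_mono
          (Icc_subset_Icc ht₁ (by linarith)) le_rfl))
      refine h4.congr ?_
      filter_upwards [Measure.quasiMeasurePreserving_fst.ae hnormal] with p hp
      exact hp p.2
    · have h5 : ∫ t in t₁..t₂, ∫ x, normalFlux f u (parallelSet Ω y) i x t ∂(κ y) =
          levelFlux f u Ω κ i t₁ t₂ y := by
        rw [intervalIntegral.integral_of_le ht, levelFlux, integral_Icc_eq_integral_Ioc]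
        congr 1 with t
        exact integral_congr_ae (hnormal.mono fun x hx => (hx t).symm)
      rw [h5]
      simp only [PiLp.sub_apply, PiLp.add_apply, hq, fluxPotential]
      linarith

end Main

theorem mainTheorem5 {n D : ℕ} (hn : 1 ≤ n)
    (f : RVec D → Fin D → RVec n) (hf : Continuous f)
    (u₀ : RVec n → RVec D) (hu₀_one : MemLp u₀ 1 volume) (hu₀_top : MemLp u₀ ⊤ volume)
    (u : RVec n → ℝ → RVec D)
    (hu_meas : AEStronglyMeasurable (Function.uncurry u)
      ((volume : Measure (RVec n × ℝ)).restrict (univ ×ˢ Ici 0)))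
    (hu_weak : IsWeakSolution f u)
    (hu_init : (fun x => u x 0) =ᵐ[volume] u₀)
    (hu_bdd : IsLocallyBounded u)
    (hu_mass : HasContinuousMass u)
    (Ω : Set (RVec n)) (hΩ : IsSmoothBounded Ω) :
    ∃ h : ℝ × ℝ → RVec D,
      (∀ t₁ t₂ : ℝ, 0 ≤ t₁ → t₁ ≤ t₂ → ∀ q : RVec D,
        IsBoundaryFlux f u Ω t₁ t₂ q ↔ q = h (t₁, t₂)) ∧
      ContinuousOn h {p : ℝ × ℝ | 0 ≤ p.1 ∧ p.1 ≤ p.2} := by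
  obtain ⟨δ, hδ⟩ := hΩ.exists_isTubularRadius hn
  obtain ⟨κ, hκf, hκ, hκv⟩ := (hΩ.isCompact_abs_signedBoundaryDist_le δ).exists_sliceKernel
    (measurable_signedBoundaryDist Ω) hδ.smooth hδ.eikonal (S := boundaryTube Ω δ)
    (fun x (hx : |signedBoundaryDist Ω x| < δ) => mem_ofPred_eq ▸ hx.le)
    (hΩ.isOpen_boundaryTube δ).measurableSet
  -- The weight `g` is fixed independently of t₁ and t₂, so the flux is a difference of values of
  -- one continuous function of time, whence joint continuity.
  obtain ⟨g, hg, hgc, hgs, hg1⟩ := exists_smooth_integral_eq_one (neg_lt_self hδ.pos)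
  have hfin : IsFiniteMeasure (volume.restrict (boundaryTube Ω δ)) :=
    ⟨by rw [Measure.restrict_apply_univ]; exact (hΩ.isBounded_boundaryTube δ).measure_lt_top⟩
  have hm := fun (i : Fin D) (T : ℝ) =>
    aestronglyMeasurable_fluxDensity (Ω := Ω) hf hu_meas (boundaryTube Ω δ) i T
  have hC := hδ.exists_ae_norm_fluxDensity_le hΩ hf hu_bdd
  have hw : ∀ i T, Integrable (Function.uncurry (fluxDensity f u Ω i))
      ((volume.restrict (boundaryTube Ω δ)).prod (volume.restrict (Icc 0 T))) := fun i T => by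
    obtain ⟨C, hC⟩ := hC i T
    exact Integrable.of_bound (hm i T) C hC
  have hw' : ∀ i T, ∀ᵐ y, Integrable (Function.uncurry (fluxDensity f u Ω i))
      ((κ y).prod (volume.restrict (Icc 0 T))) := fun i T => by
    obtain ⟨C, hC⟩ := hC i T
    exact ae_integrable_level hκv (hm i T) hC
  refine ⟨fun p => WithLp.toLp 2 fun i =>
    fluxPotential f u Ω δ g i p.2 - fluxPotential f u Ω δ g i p.1, fun t₁ t₂ ht₁ ht q => ?_, ?_⟩
  · have hflux := hδ.isBoundaryFlux hΩ hu_weak hu_bdd hu_mass hκ hκv ht₁ ht hw hw' hg hgc hgs hg1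
    exact ⟨fun hq => hq.unique hflux, fun hq => hq ▸ hflux⟩
  · refine (PiLp.continuous_toLp 2 _).comp_continuousOn (continuousOn_pi.2 fun i => ?_)
    have hc := hΩ.continuousOn_fluxPotential hu_mass hu_bdd (hw i) hg.continuous hgc
    exact (hc.comp continuousOn_snd fun p hp => hp.1.trans hp.2).sub
      (hc.comp continuousOn_fst fun p hp => hp.1)
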